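/- Let $\mathrm{twr}(0)=1$ and $\mathrm{twr}(n)=2^{\mathrm{twr}(n-1)}$ for integers $n\ge 1$. Let $F\subseteq H$ be graphs on the vertex set $\{1,\dots,k\}$. For a $k$-partite graph $T$ (with given vertex classes) let $n_H(T)$ be the number of subgraphs of $T$ that are isomorphic to $H$ and have their vertices in pairwise distinct vertex classes, and let $c_{H,F}(T)=n_H(T)/n_F(T)$ (read as $0$ if $n_F(T)=0$). For $\epsilon>0$, $T$ is called $\epsilon$-$(H,F)$-regular if $|c_{H,F}(T')-c_{H,F}(T)|\le\epsilon$ for every induced ($k$-partite) subgraph $T'$ of $T$ with $n_F(T')\ge\epsilon\, n_F(T)$. For a graph $G$ and vertex sets $X_1,\dots,X_k$ let $G[X_1,\dots,X_k]$ be the $k$-partite graph with vertex classes $X_1,\dots,X_k$ (taken as disjoint copies if they are not disjoint) in which vertices of different classes are adjacent if and only if they are adjacent in $G$. A partition $\mathcal P$ of the vertex set of a finite graph $G$ is called $\epsilon$-$(H,F)$-regular if, of all subgraphs of $G$ isomorphic to $H$, all but at most an $\epsilon$-fraction lie in an $\epsilon$-$(H,F)$-regular graph $G[X_1,\dots,X_k]$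 with $X_1,\dots,X_k\in\mathcal P$ (not necessarily distinct), with one vertex in each class $X_i$. Theorem. There are absolute constants $a,b>0$ such that for all $k$, all graphs $F\subsetneq H$ on the vertex set $\{1,\dots,k\}$ and all $\epsilon>0$ there is a finite graph $G$ such that every $\epsilon$-$(H,F)$-regular partition of $G$ has at least $$\mathrm{twr}\!\left(\left\lfloor \frac{1}{\epsilon^{a}\,(k^{k})^{b}}\right\rfloor\right)$$ parts. (The case $H=K_3$, with $F$ the path with two edges, concerns the clustering coefficient.) -/

import Mathlib

open Finset

/-- The tower function: `twr 0 = 1` and `twr (n + 1) = 2 ^ twr n`. -/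
def twr : ℕ → ℕ
  | 0 => 1
  | n + 1 => 2 ^ twr n

namespace HFRegularity

/-- `n_H(T)` for a `k`-vertex graph `H` and a `k`-partite graph `T`, whose vertex classes are the
colour classes of `cls`: the number of subgraphs of `T` that are isomorphic to `H` and have their
vertices in pairwise distinct vertex classes. -/
noncomputable def partiteCount {k : ℕ} {V : Type*} (H : SimpleGraph (Fin k)) (T : SimpleGraph V)
    (cls : T.Coloring (Fin k)) : ℕ :=
  Set.ncard {K : T.Subgraph | Nonempty (H ≃g K.coe) ∧ Set.InjOn cls K.verts}

/-- The `(H, F)`-coefficient `n_H(T) / n_F(T)` of a `k`-partite graph `T`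
(read as `0` when `n_F(T) = 0`, in which case `n_H(T) = 0` if `F ≤ H`). -/
noncomputable def coeff {k : ℕ} {V : Type*} (H F : SimpleGraph (Fin k)) (T : SimpleGraph V)
    (cls : T.Coloring (Fin k)) : ℝ :=
  (partiteCount H T cls : ℝ) / (partiteCount F T cls : ℝ)

/-- The vertex classes inherited by the subgraph of a `k`-partite graph induced on `U`. -/
def restrictClasses {k : ℕ} {V : Type*} {T : SimpleGraph V} (cls : T.Coloring (Fin k))
    (U : Set V) : (T.induce U).Coloring (Fin k) :=
  SimpleGraph.Coloring.mk (fun v => cls v.1) (fun {_ _} h => cls.valid h)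

/-- A `k`-partite graph `T` is `ε`-`(H, F)`-regular if the coefficient of every induced `k`-partite
subgraph with at least `ε * n_F(T)` copies of `F` is within `ε` of that of `T`. -/
def IsRegular {k : ℕ} {V : Type*} (H F : SimpleGraph (Fin k)) (ε : ℝ) (T : SimpleGraph V)
    (cls : T.Coloring (Fin k)) : Prop :=
  ∀ U : Set V,
    ε * (partiteCount F T cls : ℝ) ≤ (partiteCount F (T.induce U) (restrictClasses cls U) : ℝ) →
    |coeff H F (T.induce U) (restrictClasses cls U) - coeff H F T cls| ≤ ε

/-- The `k`-partite graph `G[X 0, …, X (k-1)]`: its `i`-th vertex class is `X i`, and vertices of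
different classes are adjacent iff they are adjacent in `G`. If the sets `X i` are not disjoint,
the classes are disjoint copies of them. -/
def partiteGraph {k : ℕ} {W : Type*} (G : SimpleGraph W) (X : Fin k → Finset W) :
    SimpleGraph (Σ i : Fin k, {w : W // w ∈ X i}) where
  Adj p q := p.1 ≠ q.1 ∧ G.Adj p.2.1 q.2.1
  symm := ⟨fun _ _ h => ⟨h.1.symm, h.2.symm⟩⟩
  loopless := ⟨fun _ h => h.1 rfl⟩

/-- The vertex classes of `G[X 0, …, X (k-1)]`. -/
def partiteClasses {k : ℕ} {W : Type*} (G : SimpleGraph W) (X : Fin k → Finset W) :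
    (partiteGraph G X).Coloring (Fin k) :=
  SimpleGraph.Coloring.mk (fun p => p.1) (fun {_ _} h => h.1)

/-- The subgraph `K` of `G` lies in `G[X 0, …, X (k-1)]`, with exactly one vertex in each class. -/
def LiesIn {k : ℕ} {W : Type*} {G : SimpleGraph W} (K : G.Subgraph) (X : Fin k → Finset W) : Prop :=
  ∃ f : Fin k ≃ K.verts, ∀ i, (f i : W) ∈ X i

/-- A vertex partition `P` of `G` is `ε`-`(H, F)`-regular if all but at most `ε * n_H(G)` of the
copies of `H` in `G` lie in `ε`-`(H, F)`-regular graphs `G[X 0, …, X (k-1)]` with all `X i` parts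
of `P`. (The parts `X i` are not required to be distinct; requiring this would make fewer
partitions regular.) -/
def IsRegularPartition {k : ℕ} {W : Type*} [Fintype W] [DecidableEq W] (H F : SimpleGraph (Fin k))
    (ε : ℝ) (G : SimpleGraph W) (P : Finpartition (univ : Finset W)) : Prop :=
  (Set.ncard {K : G.Subgraph | Nonempty (H ≃g K.coe) ∧
      ¬ ∃ X : Fin k → Finset W, (∀ i, X i ∈ P.parts) ∧ LiesIn K X ∧
        IsRegular H F ε (partiteGraph G X) (partiteClasses G X)} : ℝ)
    ≤ ε * (G.copyCount H : ℝ)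

end HFRegularity

/-! Some edge `uw` of `H` is missing from `F`. Blow up `H`, completely at every edge except `uw`,
where the pairs are joined by a bipartite graph `E` (`towerRel`). Copies of `F` ignore `E`: up to a
factor `k ^ k` they are counted by the product of the class sizes. A rectangle of the classes `u`,
`w` that is empty in `E` carries no copy of `H`, while a full one carries a copy on every
transversal. So a tuple of parts containing large rectangles of both kinds has coefficient `0` on
one subtuple and at least `k ^ (-k) > 2 * ε` on another, and is not regular (`not_isRegular`). Hence
a regular partition induces few irregular pairs of cells for `E` (`sum_irregularCount_le`), and `E`
must be such that this forces tower many cells (`exists_many_labels`).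

The points of each side of `E` are numbers below `N = radix s` in a mixed radix system. Digit `l` of
`x` names a word in a code of length `radix l`, and the first `l` digits of `y` name a position in
it; the adjacency at level `l` is the bit found there. Codes are exponentially large, so `N` has
tower size. If the cells of `y` mostly fix the first `l` digits and few pairs are irregular, then
for most `y` the bit is nearly constant on the cell of `x`; as different codewords disagree at a
positive fraction of positions, digit `l` is then nearly constant on that cell
(`exists_concentrated`, `exists_center`). By induction, with the two sides in both roles, cells
determine all digits of most points, so there are at least `N / 2` cells.

To hold all levels in one graph, each side consists of copies of `Fin N` indexed by the plane over
`ZMod p`, and the pair of indices chooses the level. At a given level an index sees a line of `p`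
indices. Two points of a random line are independent, so line averages concentrate
(`sum_sq_line_le`), each level loses only a fraction `O(1 / p)` of the points, and the number of
levels can be proportional to `p`. -/

namespace HFRegularity

/-! ### Codes of positive relative distance. -/

/-- The Gilbert–Varshamov bound, in the weak form `|C|² ≥ 2ⁿ` for relative distance `1/16`. -/
theorem exists_code (n : ℕ) : ∃ C : Finset (Fin n → Bool), C.Nonempty ∧ 2 ^ n ≤ #C ^ 2 ∧
    ∀ x ∈ C, ∀ y ∈ C, x ≠ y → n ≤ 16 * #{v | x v ≠ y v} := by
  classical
  let good : Finset (Finset (Fin n → Bool)) :=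
    univ.filter fun C => ∀ x ∈ C, ∀ y ∈ C, x ≠ y → n ≤ 16 * #{v | x v ≠ y v}
  obtain ⟨C, hC, hmax⟩ := good.exists_max_image card ⟨∅, by simp [good]⟩
  simp only [good, mem_filter, mem_univ, true_and] at hC hmax
  have cover : ∀ y : Fin n → Bool, ∃ x ∈ C, 16 * #{v | x v ≠ y v} ≤ n := by
    intro y
    by_contra! h
    have hy : y ∉ C := fun hy => by simpa using h y hy
    have := hmax (insert y C) (by
      intro a ha b hb hab
      rw [mem_insert] at ha hb
      rcases ha with rfl | ha <;> rcases hb with rfl | hb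
      · exact absurd rfl hab
      · have := h b hb
        simp only [ne_comm (a := b _)] at this
        exact this.le
      · exact (h a ha).le
      · exact hC a ha b hb hab)
    rw [card_insert_of_notMem hy] at this
    omega
  have ball : ∀ x : Fin n → Bool, #{y : Fin n → Bool | 16 * #{v | x v ≠ y v} ≤ n} ^ 2 ≤ 2 ^ n := by
    intro x
    -- Chernoff weights: `16` to the number of agreements with `x`. The total is `17 ^ n`, and each
    -- point of the ball weighs at least `16 ^ (n - n / 16)`.
    have hsum : ∑ y : Fin n → Bool, ∏ v, (if x v ≠ y v then 1 else 16) = 17 ^ n := by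
      have := (prod_univ_sum (fun _ : Fin n => (univ : Finset Bool))
        (fun v b => if x v ≠ b then 1 else 16)).symm
      rw [Fintype.piFinset_univ] at this
      rw [this, prod_congr rfl (g := fun _ => 17), prod_const, card_univ, Fintype.card_fin]
      intro v _
      cases x v <;> simp
    set B : Finset (Fin n → Bool) := {y | 16 * #{v | x v ≠ y v} ≤ n} with hB
    have hle : #B * 16 ^ (n - n / 16) ≤ 17 ^ n := by
      rw [← hsum, ← smul_eq_mul, ← sum_const]
      refine (sum_le_sum fun y hy => ?_).trans (sum_le_univ_sum_of_nonneg fun _ => Nat.zero_le _)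
      simp only [hB, mem_filter, mem_univ, true_and] at hy
      rw [prod_ite, prod_const, prod_const, one_pow, one_mul]
      refine Nat.pow_le_pow_right (by norm_num) ?_
      have := card_filter_add_card_filter_not (s := (univ : Finset (Fin n))) (fun v => x v ≠ y v)
      rw [card_univ, Fintype.card_fin] at this
      omega
    have h4 : (16 ^ (n / 16)) ^ 4 ≤ 2 ^ n := by
      rw [← pow_mul, show 16 = 2 ^ 4 by norm_num, ← pow_mul]
      exact Nat.pow_le_pow_right two_pos (by omega)
    have h5 : #B * 16 ^ n ≤ 17 ^ n * 16 ^ (n / 16) := by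
      have := Nat.mul_le_mul_right (16 ^ (n / 16)) hle
      rwa [mul_assoc, ← pow_add, Nat.sub_add_cancel (Nat.div_le_self _ _)] at this
    have h6 : (#B ^ 2) ^ 2 * 65536 ^ n ≤ (2 ^ n) ^ 2 * 65536 ^ n :=
      calc (#B ^ 2) ^ 2 * 65536 ^ n = (#B * 16 ^ n) ^ 4 := by
            rw [mul_pow, ← pow_mul 16, mul_comm n 4, pow_mul 16]; norm_num; ring
        _ ≤ (17 ^ n * 16 ^ (n / 16)) ^ 4 := Nat.pow_le_pow_left h5 4
        _ = (17 ^ 4) ^ n * (16 ^ (n / 16)) ^ 4 := by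
            rw [mul_pow, ← pow_mul 17, mul_comm n 4, pow_mul 17]
        _ ≤ (17 ^ 4) ^ n * 2 ^ n := Nat.mul_le_mul_left _ h4
        -- Here `167042 = 2 * 17 ^ 4`, which is below `262144 = 4 * 16 ^ 4`.
        _ = 167042 ^ n := by rw [← mul_pow]; norm_num
        _ ≤ 262144 ^ n := Nat.pow_le_pow_left (by norm_num) n
        _ = (2 ^ n) ^ 2 * 65536 ^ n := by
            rw [← pow_mul, mul_comm n 2, pow_mul, ← mul_pow]; norm_num
    exact (Nat.pow_le_pow_iff_left two_ne_zero).1 (Nat.le_of_mul_le_mul_right h6 (by positivity))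
  have hne : C.Nonempty := by
    obtain ⟨x, hx, -⟩ := cover fun _ => true
    exact ⟨x, hx⟩
  refine ⟨C, hne, ?_, hC⟩
  obtain ⟨x₀, -, hx₀⟩ := C.exists_max_image
    (fun x => #{y : Fin n → Bool | 16 * #{v | x v ≠ y v} ≤ n}) hne
  have hcov : 2 ^ n ≤ #C * #{y : Fin n → Bool | 16 * #{v | x₀ v ≠ y v} ≤ n} := by
    have : (univ : Finset (Fin n → Bool)) ⊆
        C.biUnion fun x => {y : Fin n → Bool | 16 * #{v | x v ≠ y v} ≤ n} := by
      intro y _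
      obtain ⟨x, hx, hxy⟩ := cover y
      exact mem_biUnion.2 ⟨x, hx, by simpa using hxy⟩
    have h := (card_le_card this).trans (card_biUnion_le_card_mul _ _ _ hx₀)
    simpa using h
  have h := (Nat.pow_le_pow_left hcov 2).trans_eq (mul_pow _ _ _)
  have h' := h.trans (Nat.mul_le_mul_left _ (ball x₀))
  rw [sq (2 ^ n)] at h'
  exact Nat.le_of_mul_le_mul_right h' (by positivity)

theorem exists_codeword (n : ℕ) : ∃ (M : ℕ) (c : ℕ → ℕ → Bool), 0 < M ∧ 2 ^ n ≤ M ^ 2 ∧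
    ∀ a < M, ∀ b < M, a ≠ b → n ≤ 16 * #{v ∈ range n | c a v ≠ c b v} := by
  classical
  obtain ⟨C, hne, hcard, hC⟩ := exists_code n
  let e := C.equivFin.symm
  refine ⟨#C, fun a v => if h : a < #C ∧ v < n then (e ⟨a, h.1⟩).1 ⟨v, h.2⟩ else false,
    hne.card_pos, hcard, ?_⟩
  intro a ha b hb hab
  have h := hC _ (e ⟨a, ha⟩).2 _ (e ⟨b, hb⟩).2 (by
    rw [Ne, Subtype.coe_inj, e.apply_eq_iff_eq, Fin.mk.injEq]; exact hab)
  refine h.trans (Nat.mul_le_mul_left _ ?_)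
  refine card_le_card_of_injOn Fin.val ?_ Fin.val_injective.injOn
  intro v hv
  simp only [coe_filter, mem_univ, true_and, Set.mem_ofPred_eq] at hv
  simp [ha, hb, hv]

/-- The number of codewords of a code of length `n`. -/
noncomputable def codeSize (n : ℕ) : ℕ := (exists_codeword n).choose

/-- The entry at `v` of the `a`-th codeword of length `n`. -/
noncomputable def codeword (n : ℕ) : ℕ → ℕ → Bool := (exists_codeword n).choose_spec.choose

theorem codeSize_pos (n : ℕ) : 0 < codeSize n := (exists_codeword n).choose_spec.choose_spec.1

theorem two_pow_le_codeSize_sq (n : ℕ) : 2 ^ n ≤ codeSize n ^ 2 :=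
  (exists_codeword n).choose_spec.choose_spec.2.1

theorem codeword_dist {n a b : ℕ} (ha : a < codeSize n) (hb : b < codeSize n) (hab : a ≠ b) :
    n ≤ 16 * #{v ∈ range n | codeword n a v ≠ codeword n b v} :=
  (exists_codeword n).choose_spec.choose_spec.2.2 a ha b hb hab

/-! ### The mixed radix system and its bits. -/

/-- The number of possible sequences of the first `l` digits. -/
noncomputable def radix : ℕ → ℕ
  | 0 => 1
  -- Positions in the codewords named by digit `l` correspond to the possible values of the first
  -- `l` digits.
  | l + 1 => radix l * codeSize (radix l)

theorem radix_pos (l : ℕ) : 0 < radix l := by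
  induction l with
  | zero => exact one_pos
  | succ l ih => exact Nat.mul_pos ih (codeSize_pos _)

theorem radix_dvd {l m : ℕ} (h : l ≤ m) : radix l ∣ radix m := by
  induction m, h using Nat.le_induction with
  | base => exact dvd_rfl
  | succ m _ ih => exact ih.trans (Dvd.intro _ rfl)

/-- The factor 2 survives the induction because it absorbs the square root in the size of the code.
-/
theorem two_mul_twr_le_radix (m : ℕ) : 2 * twr m ≤ radix (m + 1) := by
  induction m with
  | zero =>
    have h := two_pow_le_codeSize_sq 1
    have : radix 1 = codeSize 1 := one_mul _
    simp only [twr, zero_add, this]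
    nlinarith
  | succ m ih =>
    have h1 : twr m ≠ 0 := by cases m <;> simp [twr]
    have h2 : twr (m + 1) ≤ codeSize (radix (m + 1)) := by
      have := (Nat.pow_le_pow_right two_pos ih).trans (two_pow_le_codeSize_sq _)
      rw [mul_comm, pow_mul] at this
      exact (Nat.pow_le_pow_iff_left two_ne_zero).1 this
    exact Nat.mul_le_mul (by omega) h2

/-- The `l`-th digit of `x`. -/
noncomputable def digit (l x : ℕ) : ℕ := x / radix l % codeSize (radix l)

theorem digit_lt (l x : ℕ) : digit l x < codeSize (radix l) := Nat.mod_lt _ (codeSize_pos _)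

theorem mod_radix_eq {l x y : ℕ} (h : ∀ m < l, digit m x = digit m y) :
    x % radix l = y % radix l := by
  induction l with
  | zero => simp [radix, Nat.mod_one]
  | succ l ih =>
    rw [radix, Nat.mod_mul, Nat.mod_mul, ih fun m hm => h m (by omega)]
    have := h l (by omega)
    rw [digit, digit] at this
    rw [this]

/-- The bit that decides adjacency at level `l`. -/
noncomputable def bit (l x y : ℕ) : Bool := codeword (radix l) (digit l x) (y % radix l)

/-- Since `radix l` divides `radix s`, the residues modulo `radix l` are equidistributed below
`radix s`, so the distance of the code carries over. -/
theorem bit_dist {l s x x' : ℕ} (hl : l ≤ s) (hx : digit l x ≠ digit l x') :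
    radix s ≤ 16 * #{y : Fin (radix s) | bit l x y ≠ bit l x' y} := by
  classical
  obtain ⟨d, hd⟩ := radix_dvd hl
  have h := codeword_dist (digit_lt l x) (digit_lt l x') hx
  set D := {v ∈ range (radix l) |
    codeword (radix l) (digit l x) v ≠ codeword (radix l) (digit l x') v} with hD
  have : #(D ×ˢ range d) ≤ #{y : Fin (radix s) | bit l x y ≠ bit l x' y} := by
    have hlt : ∀ q ∈ D ×ˢ range d, q.1 + radix l * q.2 < radix s := by
      intro q hq
      simp only [hD, mem_product, mem_filter, mem_range] at hq
      rw [hd]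
      nlinarith [hq.1.1, hq.2]
    refine card_le_card_of_injOn
      (fun q => if h : q.1 + radix l * q.2 < radix s then ⟨_, h⟩ else ⟨0, radix_pos s⟩) ?_ ?_
    · intro q hq
      have := hlt q hq
      simp only [hD, coe_product, Set.mem_prod, mem_coe, mem_filter, mem_range] at hq
      simp only [this, dite_true]
      refine mem_coe.2 (mem_filter.2 ⟨mem_univ _, ?_⟩)
      simp only [bit, Nat.add_mul_mod_self_left, Nat.mod_eq_of_lt hq.1.1]
      exact hq.1.2
    · intro q hq r hr hqr
      have h1 := hlt q hq
      have h2 := hlt r hr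
      simp only [hD, coe_product, Set.mem_prod, mem_coe, mem_filter, mem_range] at hq hr
      simp only [h1, h2, dite_true, Fin.mk.injEq] at hqr
      have e1 : q.1 = r.1 := by
        have := congrArg (· % radix l) hqr
        simpa [Nat.mod_eq_of_lt hq.1.1, Nat.mod_eq_of_lt hr.1.1] using this
      have e2 : q.2 = r.2 := by
        rw [e1] at hqr
        exact Nat.eq_of_mul_eq_mul_left (radix_pos l) (by omega)
      exact Prod.ext e1 e2
  rw [card_product, card_range] at this
  calc radix s = radix l * d := hd
    _ ≤ 16 * #D * d := Nat.mul_le_mul_right _ h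
    _ = 16 * (#D * d) := by ring
    _ ≤ _ := Nat.mul_le_mul_left _ this

/-! ### Irregular pairs, and concentration of a digit on cells. -/

open scoped Classical in
/-- The fibre of `f` through `x`. -/
noncomputable def cell {α Λ : Type*} [Fintype α] (f : α → Λ) (x : α) : Finset α :=
  {y | f y = f x}

theorem mem_cell {α Λ : Type*} [Fintype α] {f : α → Λ} {x y : α} : y ∈ cell f x ↔ f y = f x := by
  simp [cell]

theorem self_mem_cell {α Λ : Type*} [Fintype α] (f : α → Λ) (x : α) : x ∈ cell f x :=
  mem_cell.2 rfl

theorem cell_congr {α Λ : Type*} [Fintype α] {f : α → Λ} {x y : α} (h : f x = f y) :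
    cell f x = cell f y := by
  ext z; rw [mem_cell, mem_cell, h]

theorem card_cell_pos {α Λ : Type*} [Fintype α] (f : α → Λ) (x : α) : 0 < #(cell f x) :=
  card_pos.2 ⟨x, self_mem_cell f x⟩

/-- The cells of `x` and `y` contain two combinatorial rectangles of relative size at least `δ`,
one without and one full of pairs of `E`. -/
def IrregularPair {α β Λ Μ : Type*} [Fintype α] [Fintype β] (E : α → β → Prop) (f : α → Λ)
    (g : β → Μ) (δ : ℝ) (x : α) (y : β) : Prop :=
  (∃ S ⊆ cell f x, ∃ T ⊆ cell g y, δ * (#(cell f x) * #(cell g y)) ≤ #S * #T ∧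
    ∀ a ∈ S, ∀ b ∈ T, ¬ E a b) ∧
  (∃ S ⊆ cell f x, ∃ T ⊆ cell g y, δ * (#(cell f x) * #(cell g y)) ≤ #S * #T ∧
    ∀ a ∈ S, ∀ b ∈ T, E a b)

theorem IrregularPair.swap {α β Λ Μ : Type*} [Fintype α] [Fintype β] {E : α → β → Prop} {f : α → Λ}
    {g : β → Μ} {δ : ℝ} {x : α} {y : β} (h : IrregularPair E f g δ x y) :
    IrregularPair (fun b a => E a b) g f δ y x := by
  obtain ⟨⟨S, hS, T, hT, h1, h2⟩, S', hS', T', hT', h3, h4⟩ := h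
  refine ⟨⟨T, hT, S, hS, ?_, fun b hb a ha => h2 a ha b hb⟩,
    T', hT', S', hS', ?_, fun b hb a ha => h4 a ha b hb⟩
  · rwa [mul_comm (#(cell g y) : ℝ), mul_comm (#T : ℝ)]
  · rwa [mul_comm (#(cell g y) : ℝ), mul_comm (#T' : ℝ)]

theorem IrregularPair.congr {α β Λ Μ : Type*} [Fintype α] [Fintype β] {E : α → β → Prop} {f : α → Λ}
    {g : β → Μ} {δ : ℝ} {x x' : α} {y y' : β} (hx : f x = f x') (hy : g y = g y') :
    IrregularPair E f g δ x y ↔ IrregularPair E f g δ x' y' := by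
  simp only [IrregularPair, cell_congr hx, cell_congr hy]

open scoped Classical in
/-- If almost all `y` hardly split `Z`, while points of `Z` with distinct values of `d` are
separated by many `y`, then `d` is almost constant on `Z`. -/
theorem exists_concentrated {α β γ : Type*} [Fintype β] [Nonempty β] (Z : Finset α)
    (hZ : Z.Nonempty) (h : α → β → Bool) (d : α → γ) (B : Finset β)
    (hB : 32 * #B ≤ Fintype.card β) {δ : ℝ}
    (hdist : ∀ x ∈ Z, ∀ x' ∈ Z, d x ≠ d x' → Fintype.card β ≤ 16 * #{y | h x y ≠ h x' y})
    (hgood : ∀ y ∉ B, (#{x ∈ Z | h x y = false} : ℝ) ≤ 2 * δ * #Z ∨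
      (#{x ∈ Z | h x y = true} : ℝ) ≤ 2 * δ * #Z) :
    ∃ x₀ ∈ Z, (#{x ∈ Z | d x ≠ d x₀} : ℝ) ≤ 128 * δ * #Z := by
  obtain ⟨x₀, hx₀, hmin⟩ := Z.exists_min_image (fun x₀ => #{x ∈ Z | d x ≠ d x₀}) hZ
  refine ⟨x₀, hx₀, ?_⟩
  have hZpos : (0 : ℝ) < #Z := by exact_mod_cast hZ.card_pos
  have hβ : (0 : ℝ) < Fintype.card β := by exact_mod_cast Fintype.card_pos
  -- the number of triples `(x, x', y)` with `y ∉ B` separating `x` and `x'`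
  have upper : ∀ y ∉ B, (∑ x ∈ Z, #{x' ∈ Z | h x y ≠ h x' y} : ℝ) ≤ 4 * δ * #Z * #Z := by
    intro y hy
    have e : (∑ x ∈ Z, #{x' ∈ Z | h x y ≠ h x' y} : ℝ) =
        2 * (#{x ∈ Z | h x y = false} * #{x ∈ Z | h x y = true}) := by
      rw [← sum_filter_add_sum_filter_not Z (fun x => h x y = true)]
      rw [sum_congr rfl (g := fun _ => (#{x ∈ Z | h x y = false} : ℝ)),
        sum_congr (s₁ := filter (fun x => ¬ h x y = true) Z) rfl
          (g := fun _ => (#{x ∈ Z | h x y = true} : ℝ))]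
      · simp only [sum_const, nsmul_eq_mul, Bool.not_eq_true]; ring
      · intro x hx
        rw [mem_filter, Bool.not_eq_true] at hx
        exact congrArg _ (congrArg card (filter_congr fun x' _ => by
          rw [hx.2]; cases h x' y <;> simp))
      · intro x hx
        rw [mem_filter] at hx
        simp [hx.2]
    rw [e]
    have h0 : (#{x ∈ Z | h x y = false} : ℝ) ≤ #Z := by exact_mod_cast card_filter_le _ _
    have h1 : (#{x ∈ Z | h x y = true} : ℝ) ≤ #Z := by exact_mod_cast card_filter_le _ _
    have h0' : (0 : ℝ) ≤ #{x ∈ Z | h x y = false} := Nat.cast_nonneg _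
    have h1' : (0 : ℝ) ≤ #{x ∈ Z | h x y = true} := Nat.cast_nonneg _
    rcases hgood y hy with hg | hg
    · nlinarith [mul_le_mul hg h1 h1' (h0'.trans hg)]
    · nlinarith [mul_le_mul h0 hg h1' hZpos.le]
  have lower : ∀ x ∈ Z, ∀ x' ∈ Z, d x' ≠ d x →
      (Fintype.card β : ℝ) ≤ 32 * #{y ∈ Bᶜ | h x y ≠ h x' y} := by
    intro x hx x' hx' hd
    have h1 := hdist x hx x' hx' hd.symm
    have h2 : #{y | h x y ≠ h x' y} ≤ #{y ∈ Bᶜ | h x y ≠ h x' y} + #B := by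
      refine (card_le_card ?_).trans (card_union_le _ _)
      intro y hy
      simp only [mem_filter, mem_univ, true_and, mem_union, mem_compl] at hy ⊢
      tauto
    exact_mod_cast (by omega : Fintype.card β ≤ 32 * #{y ∈ Bᶜ | h x y ≠ h x' y})
  have hcount : (∑ x ∈ Z, ∑ x' ∈ Z, #{y ∈ Bᶜ | h x y ≠ h x' y} : ℝ) =
      ∑ y ∈ Bᶜ, ∑ x ∈ Z, (#{x' ∈ Z | h x y ≠ h x' y} : ℝ) := by
    simp only [card_filter, Nat.cast_sum]
    rw [sum_comm' (s := Bᶜ) (t' := Z) (s' := fun _ => Bᶜ) (by simp [and_comm])]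
    refine sum_congr rfl fun x _ => ?_
    rw [sum_comm]
  have hup : (∑ y ∈ Bᶜ, ∑ x ∈ Z, (#{x' ∈ Z | h x y ≠ h x' y} : ℝ)) ≤
      Fintype.card β * (4 * δ * #Z * #Z) := by
    have hδ : 0 ≤ 4 * δ * #Z * #Z := by
      obtain ⟨y, hy⟩ : ∃ y, y ∉ B := by
        by_contra! hall
        have : B = univ := eq_univ_iff_forall.2 hall
        have hp : 0 < Fintype.card β := Fintype.card_pos
        rw [this, card_univ] at hB
        omega
      exact le_trans (by positivity) (upper y hy)
    calc _ ≤ ∑ y ∈ Bᶜ, (4 * δ * #Z * #Z) := sum_le_sum fun y hy => upper y (mem_compl.1 hy)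
      _ = #Bᶜ * (4 * δ * #Z * #Z) := by rw [sum_const, nsmul_eq_mul]
      _ ≤ _ := by gcongr; exact_mod_cast card_le_univ _
  -- By minimality of `x₀`, every `x` in `Z` differs in `d` from at least as many points as `x₀`
  -- does. Comparing `1 / 32` here with `4 * δ` above gives the constant `128`.
  have hlow : (#Z : ℝ) * (#{x ∈ Z | d x ≠ d x₀} * (Fintype.card β / 32)) ≤
      ∑ x ∈ Z, ∑ x' ∈ Z, (#{y ∈ Bᶜ | h x y ≠ h x' y} : ℝ) := by
    rw [← nsmul_eq_mul, ← sum_const]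
    refine sum_le_sum fun x hx => ?_
    calc (#{x ∈ Z | d x ≠ d x₀} * (Fintype.card β / 32) : ℝ)
        ≤ #{x' ∈ Z | d x' ≠ d x} * (Fintype.card β / 32) :=
          mul_le_mul_of_nonneg_right (by exact_mod_cast hmin x hx) (by positivity)
      _ = ∑ x' ∈ Z with d x' ≠ d x, (Fintype.card β / 32 : ℝ) := by rw [sum_const, nsmul_eq_mul]
      _ ≤ ∑ x' ∈ Z with d x' ≠ d x, (#{y ∈ Bᶜ | h x y ≠ h x' y} : ℝ) := by
          refine sum_le_sum fun x' hx' => ?_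
          rw [mem_filter] at hx'
          have := lower x hx x' hx'.1 hx'.2
          linarith
      _ ≤ _ := sum_le_sum_of_subset_of_nonneg (filter_subset _ _) fun _ _ _ => Nat.cast_nonneg _
  rw [hcount] at hlow
  have := hlow.trans hup
  have h3 : (Fintype.card β * #Z : ℝ) * (#{x ∈ Z | d x ≠ d x₀} : ℝ) ≤
      (Fintype.card β * #Z) * (128 * δ * #Z) := by linarith
  exact le_of_mul_le_mul_left h3 (by positivity)

open scoped Classical in
/-- Points that are atypical, or lie in a cell at least half of which is atypical, are at most three
times as many as the atypical points. -/
theorem card_not_typical_le {β Μ : Type*} [Fintype β] (g : β → Μ) (typ : β → Prop) :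
    #{y | ¬ typ y ∨ 2 * #{y' ∈ cell g y | typ y'} < #(cell g y)} ≤ 3 * #{y | ¬ typ y} := by
  have h : #{y | 2 * #{y' ∈ cell g y | typ y'} < #(cell g y)} ≤ 2 * #{y | ¬ typ y} := by
    rw [card_eq_sum_card_image g, card_eq_sum_card_fiberwise (f := g)
      (s := {y | ¬ typ y}) (t := univ.image g) (by intro y _; simp), mul_sum]
    refine (sum_le_sum fun z hz => ?_).trans
      (sum_le_sum_of_subset (image_subset_image (filter_subset _ _)))
    obtain ⟨y, hy, rfl⟩ := mem_image.1 hz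
    rw [mem_filter] at hy
    have e : #{x ∈ cell g y | typ x} + #{x ∈ cell g y | ¬ typ x} = #(cell g y) :=
      card_filter_add_card_filter_not _
    have h1 : #{x ∈ ({y | 2 * #{y' ∈ cell g y | typ y'} < #(cell g y)} : Finset β) | g x = g y}
        ≤ #(cell g y) := card_le_card fun x hx => mem_cell.2 (mem_filter.1 hx).2
    have h2 : #{x ∈ cell g y | ¬ typ x} ≤ #{x ∈ ({y | ¬ typ y} : Finset β) | g x = g y} :=
      card_le_card fun x hx => by
        simp only [mem_filter, mem_cell, mem_univ, true_and] at hx ⊢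
        exact hx.symm
    have h3 := hy.2
    omega
  rw [filter_or]
  exact (card_union_le _ _).trans (by omega)

open scoped Classical in
/-- If adjacency reads off a bit of the codeword of `x` at a position determined by the typical
points of a cell, and few pairs are irregular, then the digit of `x` is almost determined by its
cell. -/
theorem exists_center {α β L Λ Μ K V : Type*} [Fintype α] [Fintype β] [Nonempty β] [Fintype L]
    [Nonempty L] [Inhabited K] (d : α → K) (pre : β → V) (cod : K → V → Bool)
    (hcode : ∀ x x', d x ≠ d x' →
      Fintype.card β ≤ 16 * #{y | cod (d x) (pre y) ≠ cod (d x') (pre y)})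
    (f : α → Λ) (g : L → β → Μ) (typ : L → β → Prop)
    (htyp : ∀ c y y', typ c y → typ c y' → g c y = g c y' → pre y = pre y')
    (E : L → α → β → Prop) (hE : ∀ c x y, E c x y ↔ cod (d x) (pre y) = true)
    (hcount : 192 * ∑ c, #{y | ¬ typ c y} ≤ Fintype.card L * Fintype.card β)
    {δ : ℝ} (hδ : 0 ≤ δ) :
    ∃ ctr : Λ → K, (#{x | d x ≠ ctr (f x)} : ℝ) ≤ 128 * δ * Fintype.card α +
      64 * (∑ c, #{p : α × β | IrregularPair (E c) f (g c) δ p.1 p.2} : ℕ) /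
        (Fintype.card L * Fintype.card β) := by
  set irr : α → Finset (L × β) := fun x => {q | IrregularPair (E q.1) f (g q.1) δ x q.2} with hirr
  set atyp : Finset (L × β) := {q | ¬ typ q.1 q.2 ∨
    2 * #{y' ∈ cell (g q.1) q.2 | typ q.1 y'} < #(cell (g q.1) q.2)} with hatyp
  have hcard : Fintype.card (L × β) = Fintype.card L * Fintype.card β := Fintype.card_prod _ _
  -- Atypical points and bad cells together cost a factor 3, and `192 = 3 * 64`. With at most
  -- another `1 / 64` from `irr x`, the exceptional set stays below `1 / 32`.
  have hatyp_card : 64 * #atyp ≤ Fintype.card (L × β) := by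
    have : #atyp ≤ ∑ c, 3 * #{y | ¬ typ c y} := by
      rw [card_eq_sum_card_fiberwise (f := Prod.fst) (t := univ) (by intro _ _; simp)]
      refine sum_le_sum fun c _ => le_trans ?_ (card_not_typical_le (g c) (typ c))
      refine card_le_card_of_injOn Prod.snd ?_ ?_
      · rintro ⟨c', y⟩ hq
        simp only [hatyp, coe_filter, mem_filter, mem_univ, true_and, Set.mem_ofPred_eq] at hq ⊢
        obtain ⟨hq, rfl⟩ := hq
        exact hq
      · rintro ⟨c₁, y₁⟩ h₁ ⟨c₂, y₂⟩ h₂ h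
        simp only [coe_filter, Set.mem_ofPred_eq] at h₁ h₂ h
        rw [h, h₁.2, h₂.2]
    rw [← mul_sum] at this
    omega
  have key : ∀ x, 64 * #(irr x) ≤ Fintype.card (L × β) →
      ∃ k : K, (#{x' ∈ cell f x | d x' ≠ k} : ℝ) ≤ 128 * δ * #(cell f x) := by
    intro x hx
    obtain ⟨x₀, -, h₀⟩ := exists_concentrated (cell f x) ⟨x, self_mem_cell f x⟩
      (fun x (q : L × β) => cod (d x) (pre q.2)) d (atyp ∪ irr x)
      (by have := card_union_le atyp (irr x); omega) (δ := δ) (by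
        intro x₁ _ x₂ _ hd
        have := hcode x₁ x₂ hd
        have e : ({q : L × β | cod (d x₁) (pre q.2) ≠ cod (d x₂) (pre q.2)} : Finset (L × β)) =
            (univ : Finset L) ×ˢ
              ({y | cod (d x₁) (pre y) ≠ cod (d x₂) (pre y)} : Finset β) := by
          ext q; simp
        rw [e, card_product, card_univ, hcard]
        nlinarith [Nat.mul_le_mul_left (Fintype.card L) this]) (by
        rintro ⟨c, y⟩ hq
        simp only [hatyp, hirr, mem_union, mem_filter, mem_univ, true_and, not_or, not_not,
          not_lt] at hq
        obtain ⟨⟨hty, hhalf⟩, hreg⟩ := hq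
        -- If both bit values occur on more than `2 * δ` of the cell of `x`, each value set times
        -- the typical half of the cell of `y` is a rectangle of relative size at least `δ`. All
        -- these typical points read the same position, so one rectangle is empty and the other
        -- full.
        by_contra! hcon
        apply hreg
        have hhalf' : (#(cell (g c) y) : ℝ) ≤ 2 * #{y' ∈ cell (g c) y | typ c y'} := by
          exact_mod_cast hhalf
        have hpre : ∀ b ∈ ({y' ∈ cell (g c) y | typ c y'} : Finset β), pre b = pre y := by
          intro b hb
          rw [mem_filter, mem_cell] at hb
          exact htyp c b y hb.2 hty hb.1
        have hsize : ∀ m : ℝ, 2 * δ * #(cell f x) < m → δ * (#(cell f x) * #(cell (g c) y)) ≤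
            m * #{y' ∈ cell (g c) y | typ c y'} := by
          intro m hm
          calc δ * (#(cell f x) * #(cell (g c) y))
              ≤ δ * (#(cell f x) * (2 * #{y' ∈ cell (g c) y | typ c y'})) := by gcongr
            _ = (2 * δ * #(cell f x)) * #{y' ∈ cell (g c) y | typ c y'} := by ring
            _ ≤ _ := by gcongr
        refine ⟨⟨_, filter_subset _ _, _, filter_subset (typ c) _, hsize _ hcon.1, ?_⟩,
          ⟨_, filter_subset _ _, _, filter_subset (typ c) _, hsize _ hcon.2, ?_⟩⟩
        · intro a ha b hb
          rw [hE, hpre b hb, (mem_filter.1 ha).2]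
          simp
        · intro a ha b hb
          rw [hE, hpre b hb, (mem_filter.1 ha).2])
    exact ⟨d x₀, h₀⟩
  have hctr : ∀ z : Λ, ∃ k : K, ∀ x, f x = z → 64 * #(irr x) ≤ Fintype.card (L × β) →
      (#{x' ∈ cell f x | d x' ≠ k} : ℝ) ≤ 128 * δ * #(cell f x) := by
    intro z
    by_cases hz : ∃ x, f x = z ∧ 64 * #(irr x) ≤ Fintype.card (L × β)
    · obtain ⟨x, hx, hx'⟩ := hz
      obtain ⟨k, hk⟩ := key x hx'
      refine ⟨k, fun y hy _ => ?_⟩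
      rwa [cell_congr (hy.trans hx.symm)]
    · exact ⟨default, fun x hx hx' => absurd ⟨x, hx, hx'⟩ hz⟩
  choose ctr hctr using hctr
  refine ⟨ctr, ?_⟩
  have hpos : (0 : ℝ) < Fintype.card (L × β) := by exact_mod_cast Fintype.card_pos
  -- Markov's inequality: points irregular to more than `1 / 64` of all `(c, y)` are discarded.
  set bad : Finset α := {x | Fintype.card (L × β) < 64 * #(irr x)} with hbad
  have h1 : (#bad : ℝ) ≤ 64 * (∑ c, #{p : α × β | IrregularPair (E c) f (g c) δ p.1 p.2} : ℕ) /
        (Fintype.card L * Fintype.card β) := by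
    have e : ∑ c, #{p : α × β | IrregularPair (E c) f (g c) δ p.1 p.2} = ∑ x, #(irr x) := by
      simp only [hirr, card_filter, Fintype.sum_prod_type]
      rw [sum_comm]
    rw [e, ← Nat.cast_mul, ← hcard, le_div_iff₀ hpos]
    have : #bad * Fintype.card (L × β) ≤ 64 * ∑ x, #(irr x) := by
      rw [← smul_eq_mul, ← sum_const, mul_sum]
      exact (sum_le_sum fun x hx => (mem_filter.1 hx).2.le).trans
        (sum_le_univ_sum_of_nonneg fun _ => Nat.zero_le _)
    exact_mod_cast this
  have h2 : (#{x | x ∉ bad ∧ d x ≠ ctr (f x)} : ℝ) ≤ 128 * δ * Fintype.card α := by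
    rw [card_eq_sum_card_image f, ← card_univ (α := α),
      card_eq_sum_card_image f (univ : Finset α), Nat.cast_sum, Nat.cast_sum, mul_sum]
    refine (sum_le_sum fun z hz => ?_).trans
      (sum_le_sum_of_subset_of_nonneg (image_subset_image (filter_subset _ _))
        fun _ _ _ => by positivity)
    obtain ⟨x, hx, rfl⟩ := mem_image.1 hz
    simp only [hbad, mem_filter, mem_univ, true_and, not_lt] at hx
    have := hctr _ x rfl hx.1
    refine le_trans ?_ (this.trans_eq ?_)
    · refine Nat.cast_le.2 (card_le_card fun x' hx' => ?_)
      simp only [mem_filter, mem_univ, true_and] at hx'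
      exact mem_filter.2 ⟨mem_cell.2 hx'.2, hx'.2 ▸ hx'.1.2⟩
    · rfl
  have h3 : #{x | d x ≠ ctr (f x)} ≤ #{x | x ∉ bad ∧ d x ≠ ctr (f x)} + #bad := by
    refine (card_le_card fun x hx => ?_).trans (card_union_le _ _)
    simp only [mem_filter, mem_univ, true_and, mem_union] at hx ⊢
    tauto
  have h3' : (#{x | d x ≠ ctr (f x)} : ℝ) ≤ #{x | x ∉ bad ∧ d x ≠ ctr (f x)} + #bad := by
    exact_mod_cast h3
  linarith

/-! ### Lines in the plane over a finite field. -/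

/-- The index that is paired at level `τ` with `i` and has first coordinate `c`. -/
def linePoint {R : Type*} [CommRing R] (τ : R) (i : R × R) (c : R) : R × R :=
  (c, τ - i.2 - i.1 * c)

theorem sum_sum_linePoint {R : Type*} [CommRing R] [Fintype R] (τ : R) (b : R × R → ℝ) :
    ∑ i : R × R, ∑ c, b (linePoint τ i c) = Fintype.card R * ∑ j, b j := by
  simp only [Fintype.sum_prod_type]
  have h : ∀ a c : R, ∑ b', b (linePoint τ (a, b') c) = ∑ d, b (c, d) := by
    intro a c
    refine Fintype.sum_equiv ((Equiv.subLeft (τ - a * c))) _ _ fun b' => ?_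
    simp only [linePoint, Equiv.subLeft_apply]
    congr 2; ring
  calc _ = ∑ a : R, ∑ c : R, ∑ d, b (c, d) := by
        refine sum_congr rfl fun a _ => ?_
        rw [sum_comm]
        exact sum_congr rfl fun c _ => h a c
    _ = _ := by rw [sum_const, card_univ, nsmul_eq_mul]

/-- Pairwise independence: two values of a line at different abscissae determine its slope and
intercept, and can be prescribed freely. -/
theorem sum_linePoint_mul_linePoint {R : Type*} [Field R] [Fintype R] (τ : R) (b : R × R → ℝ)
    {c c' : R} (hc : c ≠ c') :
    ∑ i : R × R, b (linePoint τ i c) * b (linePoint τ i c') = (∑ d, b (c, d)) * ∑ d, b (c', d) := by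
  have hc' : c' - c ≠ 0 := sub_ne_zero.2 hc.symm
  rw [sum_mul_sum, ← Fintype.sum_prod_type']
  refine Fintype.sum_bijective (fun i => ((linePoint τ i c).2, (linePoint τ i c').2)) ?_ _ _
    fun i => rfl
  rw [Fintype.bijective_iff_injective_and_card]
  refine ⟨fun i j h => ?_, rfl⟩
  simp only [linePoint, Prod.mk.injEq] at h
  have h1 : (i.1 - j.1) * (c' - c) = 0 := by linear_combination h.1 - h.2
  have h2 : i.1 = j.1 := sub_eq_zero.1 ((mul_eq_zero.1 h1).resolve_right hc')
  refine Prod.ext h2 ?_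
  have := h.1
  rw [h2] at this
  linear_combination -this

/-- Second moment of the sums of a function over lines. -/
theorem sum_sq_line_le {R : Type*} [Field R] [Fintype R] (τ : R) (b : R × R → ℝ)
    (hb : ∀ j, 0 ≤ b j) (hb1 : ∀ j, b j ≤ 1) :
    ∑ i : R × R, (∑ c, b (linePoint τ i c) - (∑ j, b j) / Fintype.card R) ^ 2 ≤
      Fintype.card R * ∑ j, b j := by
  classical
  set B := ∑ j, b j with hB
  have hq : (0 : ℝ) < Fintype.card R := by exact_mod_cast Fintype.card_pos
  have hsq : ∑ i : R × R, (∑ c, b (linePoint τ i c)) ^ 2 ≤ Fintype.card R * B + B ^ 2 := by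
    have e : ∑ i : R × R, (∑ c, b (linePoint τ i c)) ^ 2 =
        ∑ c, ∑ c', ∑ i : R × R, b (linePoint τ i c) * b (linePoint τ i c') := by
      simp only [sq, sum_mul_sum]
      rw [sum_comm]
      exact sum_congr rfl fun c _ => sum_comm
    have e2 : B ^ 2 = ∑ c, ∑ c', (∑ d, b (c, d)) * ∑ d, b (c', d) := by
      rw [← sum_mul_sum, ← sq, hB, Fintype.sum_prod_type]
    have e3 : Fintype.card R * B = ∑ c, ∑ c', if c = c' then ∑ i, b (linePoint τ i c) else 0 := by
      rw [hB, ← sum_sum_linePoint τ b, sum_comm]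
      simp
    rw [e, e2, e3, ← sum_add_distrib]
    refine sum_le_sum fun c _ => ?_
    rw [← sum_add_distrib]
    refine sum_le_sum fun c' _ => ?_
    split_ifs with h
    · subst h
      have h1 : ∑ i, b (linePoint τ i c) * b (linePoint τ i c) ≤ ∑ i, b (linePoint τ i c) :=
        sum_le_sum fun i _ => mul_le_of_le_one_right (hb _) (hb1 _)
      have h2 : 0 ≤ (∑ d, b (c, d)) * ∑ d, b (c, d) := mul_self_nonneg _
      linarith
    · rw [zero_add, sum_linePoint_mul_linePoint τ b h]
  have hexp : ∑ i : R × R, (∑ c, b (linePoint τ i c) - B / Fintype.card R) ^ 2 =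
      ∑ i : R × R, (∑ c, b (linePoint τ i c)) ^ 2 - B ^ 2 := by
    simp only [sub_sq, sum_add_distrib, sum_sub_distrib]
    rw [← sum_mul, ← mul_sum, sum_sum_linePoint, sum_const, card_univ, Fintype.card_prod,
      nsmul_eq_mul]
    push_cast
    field_simp
    ring
  rw [hexp]
  linarith

/-! ### Typical points and the induction on levels. -/

/-- A value for the `l`-th digit on every cell of `f`, with the least possible number of errors. -/
noncomputable def center {N : ℕ} {Λ : Type*} (f : Fin N → Λ) (l : ℕ) : Λ → ℕ :=
  Function.argmin fun ctr : Λ → ℕ => #{x : Fin N | digit l x ≠ ctr (f x)}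

/-- Transfers the bound for the center found by `exists_center` to the canonical one, which makes
`Typical` independent of choices. -/
theorem card_ne_center_le {N : ℕ} {Λ : Type*} (f : Fin N → Λ) (l : ℕ) (ctr : Λ → ℕ) :
    #{x : Fin N | digit l x ≠ center f l (f x)} ≤ #{x : Fin N | digit l x ≠ ctr (f x)} :=
  Function.argmin_le (fun ctr : Λ → ℕ => #{x : Fin N | digit l x ≠ ctr (f x)}) ctr

/-- The first `l` digits of `x` are those of the center of its cell. -/
def Typical {N : ℕ} {Λ : Type*} (f : Fin N → Λ) (l : ℕ) (x : Fin N) : Prop :=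
  ∀ m < l, digit m x = center f m (f x)

theorem Typical.mod_radix_eq {N : ℕ} {Λ : Type*} {f : Fin N → Λ} {l : ℕ} {x y : Fin N}
    (hx : Typical f l x) (hy : Typical f l y) (hxy : f x = f y) :
    (x : ℕ) % radix l = y % radix l :=
  HFRegularity.mod_radix_eq fun m hm => by rw [hx m hm, hy m hm, hxy]

open scoped Classical in
theorem card_not_typical_succ_le {N : ℕ} {Λ : Type*} (f : Fin N → Λ) (l : ℕ) :
    #{x | ¬ Typical f (l + 1) x} ≤
      #{x | ¬ Typical f l x} + #{x : Fin N | digit l x ≠ center f l (f x)} := by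
  refine (card_le_card fun x hx => ?_).trans (card_union_le _ _)
  simp only [mem_filter, mem_univ, true_and, mem_union] at hx ⊢
  by_contra! h
  refine hx fun m hm => ?_
  rcases Nat.lt_succ_iff_lt_or_eq.1 hm with hm | rfl
  · exact h.1 m hm
  · exact h.2

open scoped Classical in
theorem sum_card_not_typical_succ_le {N : ℕ} {ι Λ : Type*} [Fintype ι] (f : ι → Fin N → Λ) (l : ℕ) :
    (∑ i, #{x | ¬ Typical (f i) (l + 1) x} : ℝ) ≤ ∑ i, (#{x | ¬ Typical (f i) l x} : ℝ) +
      ∑ i, (#{x : Fin N | digit l x ≠ center (f i) l (f i x)} : ℝ) := by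
  rw [← sum_add_distrib]
  exact sum_le_sum fun i _ => by exact_mod_cast card_not_typical_succ_le (f i) l

open scoped Classical in
/-- The number of irregular pairs. -/
noncomputable def irregularCount {α β Λ Μ : Type*} [Fintype α] [Fintype β] (E : α → β → Prop)
    (f : α → Λ) (g : β → Μ) (δ : ℝ) : ℕ :=
  #{q : α × β | IrregularPair E f g δ q.1 q.2}

theorem irregularCount_swap {α β Λ Μ : Type*} [Fintype α] [Fintype β] (E : α → β → Prop)
    (f : α → Λ) (g : β → Μ) (δ : ℝ) :
    irregularCount (fun b a => E a b) g f δ = irregularCount E f g δ := by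
  classical
  refine card_equiv (Equiv.prodComm _ _) fun q => ?_
  simp only [mem_filter, mem_univ, true_and, Equiv.prodComm_apply, Prod.fst_swap, Prod.snd_swap]
  exact ⟨fun h => h.swap, fun h => h.swap⟩

open scoped Classical in
/-- One level: if most points are typical on the side of `g`, then digit `l` is almost determined by
the cells of `f`. -/
theorem sum_card_ne_center_le {p : ℕ} [Fact p.Prime] {N s l : ℕ} (hN : N = radix s) (hl : l ≤ s)
    (τ : ZMod p)
    {Λ Μ : Type*} (E : ZMod p × ZMod p → ZMod p × ZMod p → Fin N → Fin N → Prop)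
    (f : ZMod p × ZMod p → Fin N → Λ) (g : ZMod p × ZMod p → Fin N → Μ)
    (hE : ∀ i c x y, E i (linePoint τ i c) x y ↔ bit l x y = true)
    (hatyp : 384 * (∑ j, #{y | ¬ Typical (g j) l y} : ℝ) ≤ p ^ 2 * N)
    {δ : ℝ} (hδ : 0 ≤ δ) :
    (∑ i, #{x : Fin N | digit l x ≠ center (f i) l (f i x)} : ℝ) ≤
      (128 * δ + 384 / p) * (p ^ 2 * N) +
      64 * (∑ i, ∑ j, irregularCount (E i j) (f i) (g j) δ : ℝ) / (p * N) := by
  have : NeZero N := ⟨(hN ▸ radix_pos s).ne'⟩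
  have hNpos : (0 : ℝ) < N := by exact_mod_cast hN ▸ radix_pos s
  have hp : (0 : ℝ) < p := by exact_mod_cast (Fact.out : p.Prime).pos
  set b : ZMod p × ZMod p → ℝ := fun j => #{y | ¬ Typical (g j) l y} / N with hb
  have hb0 : ∀ j, 0 ≤ b j := fun j => by positivity
  have hb1 : ∀ j, b j ≤ 1 := fun j => by
    rw [hb, div_le_one hNpos]
    exact_mod_cast (card_le_univ _).trans_eq (Fintype.card_fin N)
  have hB : ∑ j, b j ≤ p ^ 2 / 384 := by
    rw [hb, ← sum_div, div_le_iff₀ hNpos]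
    linarith
  -- The threshold is twice the bound `p / 384` on the mean, so Chebyshev's inequality leaves at
  -- most `384 * p` bad indices among `p ^ 2`.
  set bad : Finset (ZMod p × ZMod p) := {i | (p : ℝ) / 192 < ∑ c, b (linePoint τ i c)} with hbad
  have hbadcard : (#bad : ℝ) ≤ 384 * p := by
    have h2 := sum_sq_line_le τ b hb0 hb1
    rw [ZMod.card] at h2
    have h3 : (#bad : ℝ) * (p / 384) ^ 2 ≤
        ∑ i : ZMod p × ZMod p, (∑ c, b (linePoint τ i c) - (∑ j, b j) / p) ^ 2 := by
      rw [← nsmul_eq_mul, ← sum_const]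
      refine (sum_le_sum fun i hi => ?_).trans
        (sum_le_univ_sum_of_nonneg fun _ => sq_nonneg _)
      refine pow_le_pow_left₀ (by positivity) ?_ 2
      have h4 := (mem_filter.1 hi).2
      have h5 : (∑ j, b j) / p ≤ p / 384 := by
        rw [div_le_iff₀ hp]; linarith
      linarith
    have h6 : (#bad : ℝ) * (p / 384) ^ 2 ≤ (384 * p) * (p / 384) ^ 2 := by
      refine (h3.trans h2).trans ?_
      calc (p : ℝ) * ∑ j, b j ≤ p * (p ^ 2 / 384) := by gcongr
        _ = _ := by ring
    exact le_of_mul_le_mul_right h6 (by positivity)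
  have hgood : ∀ i ∉ bad, (#{x : Fin N | digit l x ≠ center (f i) l (f i x)} : ℝ) ≤
      128 * δ * N +
        64 * (∑ c, irregularCount (E i (linePoint τ i c)) (f i) (g (linePoint τ i c)) δ : ℝ) /
          (p * N) := by
    intro i hi
    obtain ⟨ctr, hctr⟩ := exists_center (fun x : Fin N => digit l x) (fun y : Fin N => y % radix l)
      (codeword (radix l))
      (fun x x' hx => by
        rw [Fintype.card_fin]
        subst hN
        exact bit_dist hl hx)
      (f i) (fun c => g (linePoint τ i c)) (fun c => Typical (g (linePoint τ i c)) l)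
      (fun c y y' h h' e => h.mod_radix_eq h' e) (fun c => E i (linePoint τ i c))
      (fun c x y => hE i c x y) (by
        simp only [hbad, mem_filter, mem_univ, true_and, not_lt, hb, ← sum_div] at hi
        rw [div_le_iff₀ hNpos] at hi
        rw [ZMod.card, Fintype.card_fin]
        have : 192 * (∑ c, #{y | ¬ Typical (g (linePoint τ i c)) l y} : ℝ) ≤ p * N := by linarith
        exact_mod_cast this) hδ
    rw [ZMod.card, Fintype.card_fin] at hctr
    push_cast at hctr
    exact le_trans (by exact_mod_cast card_ne_center_le (f i) l ctr) hctr
  have hline : ∀ i,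
      (∑ c, irregularCount (E i (linePoint τ i c)) (f i) (g (linePoint τ i c)) δ : ℝ) ≤
      ∑ j, (irregularCount (E i j) (f i) (g j) δ : ℝ) := by
    intro i
    have hinj : Function.Injective (linePoint τ i) := fun c c' h => congrArg Prod.fst h
    have := sum_map univ ⟨linePoint τ i, hinj⟩ fun j =>
      (irregularCount (E i j) (f i) (g j) δ : ℝ)
    simp only [Function.Embedding.coeFn_mk] at this
    rw [← this]
    exact sum_le_univ_sum_of_nonneg fun _ => Nat.cast_nonneg _
  have hall : ∀ i, (#{x : Fin N | digit l x ≠ center (f i) l (f i x)} : ℝ) ≤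
      (if i ∈ bad then (N : ℝ) else 0) + (128 * δ * N +
        64 * (∑ j, irregularCount (E i j) (f i) (g j) δ : ℝ) / (p * N)) := by
    intro i
    split_ifs with h
    · have h1 : (#{x : Fin N | digit l x ≠ center (f i) l (f i x)} : ℝ) ≤ N := by
        exact_mod_cast (card_le_univ _).trans_eq (Fintype.card_fin N)
      have h2 : (0 : ℝ) ≤ 128 * δ * N +
          64 * (∑ j, irregularCount (E i j) (f i) (g j) δ : ℝ) / (p * N) := by positivity
      linarith
    · rw [zero_add]
      refine (hgood i h).trans ?_
      gcongr
      exact hline i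
  refine (sum_le_sum fun i _ => hall i).trans ?_
  rw [sum_add_distrib, sum_add_distrib, sum_const, card_univ, Fintype.card_prod, ZMod.card,
    ← sum_div, ← mul_sum, sum_ite_mem, univ_inter, sum_const, nsmul_eq_mul, nsmul_eq_mul]
  have : (#bad : ℝ) * N ≤ 384 / p * (p ^ 2 * N) := by
    calc (#bad : ℝ) * N ≤ 384 * p * N := by gcongr
      _ = _ := by field_simp
  push_cast
  linarith

/-- The bipartite graph that needs tower-size regular partitions. The pair of indices of two points
determines the level at which their adjacency is decided, and the parity of the level the side whose
codeword is read. -/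
noncomputable def towerRel {p N : ℕ} (i j : ZMod p × ZMod p) (x y : Fin N) : Prop :=
  let t := (i.1 * j.1 + i.2 + j.2).val
  if Even t then bit (t / 2) x y = true else bit (t / 2) y x = true

/-- The bound on `l` ensures that the residue modulo `p` gives back the level as an integer. -/
theorem towerRel_even {p N l : ℕ} (hl : 2 * l < p) (i : ZMod p × ZMod p) (c : ZMod p)
    (x y : Fin N) :
    towerRel i (linePoint ((2 * l : ℕ) : ZMod p) i c) x y ↔ bit l x y = true := by
  have h : i.1 * (linePoint ((2 * l : ℕ) : ZMod p) i c).1 + i.2 +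
      (linePoint ((2 * l : ℕ) : ZMod p) i c).2 = ((2 * l : ℕ) : ZMod p) := by
    simp only [linePoint]; ring
  rw [towerRel, h, ZMod.val_natCast_of_lt hl]
  simp

theorem towerRel_odd {p N l : ℕ} (hl : 2 * l + 1 < p) (i : ZMod p × ZMod p) (c : ZMod p)
    (x y : Fin N) :
    towerRel (linePoint ((2 * l + 1 : ℕ) : ZMod p) i c) i y x ↔ bit l x y = true := by
  have h : (linePoint ((2 * l + 1 : ℕ) : ZMod p) i c).1 * i.1 +
      (linePoint ((2 * l + 1 : ℕ) : ZMod p) i c).2 + i.2 = ((2 * l + 1 : ℕ) : ZMod p) := by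
    simp only [linePoint]; ring
  rw [towerRel, h, ZMod.val_natCast_of_lt hl]
  have : ¬ Even (2 * l + 1) := by simp
  have h2 : (2 * l + 1) / 2 = l := by omega
  simp only [this, if_false, h2]

open scoped Classical in
/-- A pair of labellings with few irregular pairs has many labels on some fibre. -/
theorem exists_many_labels {p : ℕ} [Fact p.Prime] {N s : ℕ} (hN : N = radix s)
    (hps : 442368 * s ≤ p)
    {Λ Μ : Type*} [DecidableEq Λ] (f : ZMod p × ZMod p → Fin N → Λ)
    (g : ZMod p × ZMod p → Fin N → Μ)
    (hirr : (∑ i, ∑ j, irregularCount (towerRel i j) (f i) (g j) (1 / p) : ℝ) ≤ p ^ 2 * N ^ 2) :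
    ∃ i, N ≤ 2 * #(univ.image (f i)) := by
  have hNpos : (0 : ℝ) < N := by exact_mod_cast hN ▸ radix_pos s
  have hp : (0 : ℝ) < p := by exact_mod_cast (Fact.out : p.Prime).pos
  have hps' : (442368 * s : ℝ) ≤ p := by exact_mod_cast hps
  have hirr' :
      (∑ i, ∑ j, irregularCount (fun x y => towerRel j i y x) (g i) (f j) (1 / p) : ℝ) ≤
      p ^ 2 * N ^ 2 := by
    refine le_trans (le_of_eq ?_) hirr
    rw [sum_comm]
    exact sum_congr rfl fun i _ => sum_congr rfl fun j _ =>
      congrArg _ (irregularCount_swap (towerRel i j) (f i) (g j) _)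
  -- Each level loses a fraction `128 / p + 384 / p + 64 / p = 576 / p` of the points: concentration
  -- at `δ = 1 / p`, bad lines, irregular pairs.
  have step : ∀ l ≤ s,
      (∑ i, #{x | ¬ Typical (f i) l x} : ℝ) ≤ l * (576 * p * N) ∧
      (∑ i, #{x | ¬ Typical (g i) l x} : ℝ) ≤ l * (576 * p * N) := by
    intro l
    induction l with
    | zero => simp [Typical]
    | succ l ih =>
      intro hl
      obtain ⟨hf, hg⟩ := ih (by omega)
      have hlt : 2 * l + 1 < p := by omega
      have hle : (l : ℝ) + 1 ≤ s := by exact_mod_cast hl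
      -- The atypical fraction must stay below `1 / 384` at every level; `442368 = 2 * 384 * 576` is
      -- more than enough.
      have small : (384 : ℝ) * (l * (576 * p * N)) ≤ p ^ 2 * N := by
        have : (384 * 576 * l : ℝ) ≤ p := by
          have : (0 : ℝ) ≤ l := Nat.cast_nonneg l
          linarith
        calc (384 : ℝ) * (l * (576 * p * N)) = (384 * 576 * l) * (p * N) := by ring
          _ ≤ p * (p * N) := by gcongr
          _ = _ := by ring
      have conv : ∀ I : ℝ, I ≤ p ^ 2 * N ^ 2 →
          (128 * (1 / p) + 384 / p) * (p ^ 2 * N) + 64 * I / (p * N) ≤ 576 * p * N := by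
        intro I hI
        have : 64 * I / (p * N) ≤ 64 * p * N := by
          rw [div_le_iff₀ (by positivity)]
          nlinarith
        have e : (128 * (1 / p) + 384 / p) * (p ^ 2 * N) = 512 * p * (N : ℝ) := by
          field_simp; norm_num
        linarith
      have h1 := sum_card_ne_center_le hN (l := l) (by omega) ((2 * l : ℕ) : ZMod p) towerRel
        f g (fun i c x y => towerRel_even (by omega) i c x y) (by linarith) (δ := 1 / p)
        (by positivity)
      have h2 := sum_card_ne_center_le hN (l := l) (by omega) ((2 * l + 1 : ℕ) : ZMod p)
        (fun i j x y => towerRel j i y x)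
        g f (fun i c x y => towerRel_odd hlt i c x y) (by linarith) (δ := 1 / p)
        (by positivity)
      have h1' := h1.trans (conv _ hirr)
      have h2' := h2.trans (conv _ hirr')
      have a1 := sum_card_not_typical_succ_le f l
      have a2 := sum_card_not_typical_succ_le g l
      push_cast
      constructor <;> linarith
  obtain ⟨hf, -⟩ := step s le_rfl
  obtain ⟨i, -, hi⟩ : ∃ i ∈ (univ : Finset (ZMod p × ZMod p)),
      (#{x | ¬ Typical (f i) s x} : ℝ) ≤ N / 2 := by
    refine exists_le_of_sum_le univ_nonempty (hf.trans ?_)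
    rw [sum_const, card_univ, Fintype.card_prod, ZMod.card, nsmul_eq_mul]
    push_cast
    have : (0 : ℝ) ≤ p * N := by positivity
    nlinarith
  refine ⟨i, ?_⟩
  have hsplit : #{x | Typical (f i) s x} + #{x | ¬ Typical (f i) s x} = N := by
    rw [card_filter_add_card_filter_not, card_univ, Fintype.card_fin]
  -- Typical points with the same label agree modulo `radix s = N`, hence are equal.
  have hinj : #{x | Typical (f i) s x} ≤ #(univ.image (f i)) := by
    refine card_le_card_of_injOn (f i) (fun x _ => by simp) fun x hx y hy hxy => ?_
    simp only [coe_filter, mem_univ, true_and, Set.mem_ofPred_eq] at hx hy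
    have := hx.mod_radix_eq hy hxy
    rw [← hN, Nat.mod_eq_of_lt x.2, Nat.mod_eq_of_lt y.2] at this
    exact Fin.ext this
  have h2 : 2 * #{x | ¬ Typical (f i) s x} ≤ N := by
    have : (2 * #{x | ¬ Typical (f i) s x} : ℝ) ≤ N := by linarith
    exact_mod_cast this
  omega

/-! ### Counting copies in `k`-partite graphs. -/

theorem exists_copy_of_iso {α V : Type*} {F : SimpleGraph α} {T : SimpleGraph V} {K : T.Subgraph}
    (h : Nonempty (F ≃g K.coe)) : ∃ f : F.Copy T, f.toSubgraph = K :=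
  (Set.ext_iff.1 SimpleGraph.Copy.range_toSubgraph K).2 h

theorem toSubgraph_verts {α V : Type*} {F : SimpleGraph α} {T : SimpleGraph V} (f : F.Copy T) :
    f.toSubgraph.verts = Set.range f := by
  simp [SimpleGraph.Copy.toSubgraph]

theorem injective_comp_copy {α V ι : Type*} {F : SimpleGraph α} {T : SimpleGraph V} {c : V → ι}
    {f : F.Copy T} (h : Set.InjOn c f.toSubgraph.verts) : Function.Injective fun i => c (f i) := by
  rw [toSubgraph_verts] at h
  exact fun i j hij => f.injective (h ⟨i, rfl⟩ ⟨j, rfl⟩ hij)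

/-- A transversal copy is determined by the assignment of its vertices to the classes and by one
vertex in each class. -/
theorem partiteCount_le {k : ℕ} {V : Type*} [Finite V] (F : SimpleGraph (Fin k)) (T : SimpleGraph V)
    (cls : T.Coloring (Fin k)) :
    partiteCount F T cls ≤ k ^ k * ∏ a, Nat.card {v // cls v = a} := by
  classical
  set I := {f : F.Copy T // Function.Injective fun i => cls (f i)}
  have : Finite (F.Copy T) := Finite.of_injective _ DFunLike.coe_injective
  have h1 : partiteCount F T cls ≤ Nat.card I := by
    rw [← Set.ncard_univ, partiteCount]
    refine (Set.ncard_le_ncard (t := (fun f : I => f.1.toSubgraph) '' Set.univ) ?_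
      (Set.toFinite _)).trans (Set.ncard_image_le (Set.toFinite _))
    rintro K ⟨hK, hinj⟩
    obtain ⟨f, rfl⟩ := exists_copy_of_iso hK
    exact ⟨⟨f, injective_comp_copy hinj⟩, trivial, rfl⟩
  have hbij : ∀ f : I, Function.Bijective fun i => cls (f.1 i) := fun f =>
    Finite.injective_iff_bijective.1 f.2
  let m : I → (Fin k → Fin k) × ∀ a, {v // cls v = a} := fun f =>
    (fun i => cls (f.1 i), fun a => ⟨f.1 ((Equiv.ofBijective _ (hbij f)).symm a),
      (Equiv.ofBijective _ (hbij f)).apply_symm_apply a⟩)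
  have hm : Function.Injective m := by
    intro f g h
    have h1 := congrArg Prod.fst h
    have h2 := congrArg Prod.snd h
    have key : ∀ (f : I) (i : Fin k), ((m f).2 ((m f).1 i)).1 = f.1 i := fun f i => by
      simp only [m]
      exact congrArg f.1 ((Equiv.ofBijective _ (hbij f)).symm_apply_apply i)
    refine Subtype.ext (SimpleGraph.Copy.ext fun i => ?_)
    rw [← key f, ← key g, h]
  refine h1.trans ((Nat.card_le_card_of_injective m hm).trans_eq ?_)
  rw [Nat.card_prod, Nat.card_pi, Nat.card_pi]
  simp

/-- With the assignment to classes fixed by `σ`, the vertex set of a copy already determines the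
transversal, so different transversals give different subgraphs. -/
theorem card_le_partiteCount {k : ℕ} {V D : Type*} [Finite V] (F : SimpleGraph (Fin k))
    (T : SimpleGraph V) (cls : T.Coloring (Fin k)) (m : D → Fin k → V)
    (hm : Function.Injective m) (σ : Fin k → Fin k) (hσ : Function.Injective σ)
    (hcls : ∀ d a, cls (m d a) = σ a) (hadj : ∀ d a b, F.Adj a b → T.Adj (m d a) (m d b)) :
    Nat.card D ≤ partiteCount F T cls := by
  have hinj : ∀ d, Function.Injective (m d) := fun d a b h => hσ (by rw [← hcls d, h, hcls])
  let c : D → F.Copy T := fun d => ⟨⟨m d, hadj d _ _⟩, hinj d⟩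
  rw [← Set.ncard_univ, partiteCount]
  refine Set.ncard_le_ncard_of_injOn (fun d => (c d).toSubgraph) ?_ ?_ (Set.toFinite _)
  · intro d _
    refine ⟨⟨(c d).isoToSubgraph⟩, ?_⟩
    rw [toSubgraph_verts]
    rintro _ ⟨a, rfl⟩ _ ⟨b, rfl⟩ h
    exact congrArg (m d) (hσ ((hcls d a).symm.trans (h.trans (hcls d b))))
  · intro d _ d' _ h
    have hv := congrArg SimpleGraph.Subgraph.verts h
    simp only [toSubgraph_verts] at hv
    refine hm (funext fun a => ?_)
    obtain ⟨b, hb⟩ : m d a ∈ Set.range (m d') := hv ▸ ⟨a, rfl⟩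
    have : σ b = σ a := by rw [← hcls d' b, hb, hcls]
    rw [← hb, hσ this]

/-- A graph that maps to a proper subgraph of `H`, injectively on transversals, has no copies
of `H`. -/
theorem partiteCount_eq_zero {k : ℕ} {V : Type*} (H : SimpleGraph (Fin k)) (T : SimpleGraph V)
    (cls : T.Coloring (Fin k)) (h : Fin k → Fin k) (hh : Function.Injective h) {u w : Fin k}
    (huw : H.Adj u w) (hadj : ∀ x y, T.Adj x y → H.Adj (h (cls x)) (h (cls y)))
    (hne : ∀ x y, T.Adj x y → h (cls x) = u → h (cls y) ≠ w) :
    partiteCount H T cls = 0 := by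
  have hempty : {K : T.Subgraph | Nonempty (H ≃g K.coe) ∧ Set.InjOn cls K.verts} = ∅ := by
    refine Set.eq_empty_iff_forall_notMem.2 ?_
    rintro K ⟨hK, hinj⟩
    obtain ⟨f, rfl⟩ := exists_copy_of_iso hK
    let r : H →g H := ⟨fun i => h (cls (f i)), fun hij => hadj _ _ (f.toHom.map_rel hij)⟩
    have hr : Function.Injective r := hh.comp (injective_comp_copy hinj)
    -- An injective endomorphism of a finite graph permutes its edges, so it would have to hit `uw`.
    obtain ⟨⟨e, he⟩, hre⟩ := Finite.injective_iff_surjective.1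
      (SimpleGraph.Hom.mapEdgeSet.injective r hr) ⟨s(u, w), huw⟩
    induction e using Sym2.ind with
    | _ i j =>
      have hre' : s(r i, r j) = s(u, w) := congrArg Subtype.val hre
      have hij : T.Adj (f i) (f j) := f.toHom.map_rel he
      rcases Sym2.eq_iff.1 hre' with ⟨h1, h2⟩ | ⟨h1, h2⟩
      · exact hne _ _ hij h1 h2
      · exact hne _ _ hij.symm h2 h1
  rw [partiteCount, hempty, Set.ncard_empty]

/-! ### Blow-ups and their irregular tuples. -/

/-- The blow-up of `H` with vertex classes `Ω`, in which the pairs of the edge `uw` are joined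
according to `E`, and those of the other edges completely. -/
def edgeBlowup {k : ℕ} {Ω : Type*} (H : SimpleGraph (Fin k)) (u w : Fin k) (E : Ω → Ω → Prop) :
    SimpleGraph (Fin k × Ω) where
  Adj p q := H.Adj p.1 q.1 ∧ (p.1 = u → q.1 = w → E p.2 q.2) ∧ (p.1 = w → q.1 = u → E q.2 p.2)
  symm := ⟨fun _ _ h => ⟨h.1.symm, fun h1 h2 => h.2.2 h2 h1, fun h1 h2 => h.2.1 h2 h1⟩⟩
  loopless := ⟨fun _ h => h.1.ne rfl⟩

section Subtuple

variable {k : ℕ} {Ω W : Type*} (φ : Fin k × Ω ≃ W) (X : Fin k → Finset W) (σ : Fin k ≃ Fin k)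
  (S : Fin k → Finset Ω)

/-- The vertices of `G[X 0, …, X (k-1)]` given by subsets `S a` of the classes of a blow-up, where
`S a` is placed in the vertex class `X (σ a)`. -/
def subtuple : Set (Σ i : Fin k, {w : W // w ∈ X i}) :=
  {v | ∃ ω ∈ S (σ.symm v.1), v.2.1 = φ (σ.symm v.1, ω)}

theorem partiteCount_subtuple_le [Finite W] (F : SimpleGraph (Fin k)) (G : SimpleGraph W) :
    partiteCount F ((partiteGraph G X).induce (subtuple φ X σ S))
      (restrictClasses (partiteClasses G X) (subtuple φ X σ S)) ≤ k ^ k * ∏ a, #(S a) := by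
  refine (partiteCount_le _ _ _).trans (Nat.mul_le_mul_left _ ?_)
  rw [← Equiv.prod_comp σ.symm fun a => #(S a)]
  refine prod_le_prod' fun a _ => ?_
  have hmem : ∀ v : {v // restrictClasses (partiteClasses G X) (subtuple φ X σ S) v = a},
      ∃ ω : S (σ.symm a), v.1.1.2.1 = φ (σ.symm a, ω.1) := by
    rintro ⟨⟨⟨i, x⟩, ω, hω, hx⟩, rfl⟩
    exact ⟨⟨ω, hω⟩, hx⟩
  choose g hg using hmem
  refine (Nat.card_le_card_of_injective g ?_).trans_eq (by simp)
  intro v v' h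
  have h1 := (hg v).trans ((congrArg (fun ω => φ (σ.symm a, ω.1)) h).trans (hg v').symm)
  obtain ⟨⟨⟨i, x⟩, hx⟩, rfl⟩ := v
  obtain ⟨⟨⟨j, y⟩, hy⟩, hij⟩ := v'
  obtain rfl : j = i := hij
  have hxy : x = y := Subtype.ext h1
  subst hxy
  rfl

variable {φ X σ S} {H : SimpleGraph (Fin k)} {u w : Fin k} {E : Ω → Ω → Prop}

/-- For `F` without the edge `uw` the condition on `E` is void; for `H` itself it asks for a full
rectangle. -/
theorem prod_card_le_partiteCount_subtuple [Finite W] {F : SimpleGraph (Fin k)} (hF : F ≤ H)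
    (hX : ∀ a, ∀ x ∈ S a, φ (a, x) ∈ X (σ a))
    (hE : F.Adj u w → ∀ x ∈ S u, ∀ y ∈ S w, E x y) :
    ∏ a, #(S a) ≤ partiteCount F
      ((partiteGraph ((edgeBlowup H u w E).comap φ.symm) X).induce (subtuple φ X σ S))
      (restrictClasses (partiteClasses _ X) (subtuple φ X σ S)) := by
  have hcard : ∏ a, #(S a) = Nat.card (∀ a, S a) := by simp
  rw [hcard]
  refine card_le_partiteCount F _ _
    (fun d a => ⟨⟨σ a, ⟨φ (a, (d a).1), hX a _ (d a).2⟩⟩,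
      (d a).1, by simp, by simp⟩) ?_ σ σ.injective (fun _ _ => rfl) ?_
  · intro d d' h
    refine funext fun a => Subtype.ext ?_
    have h1 : φ (a, (d a).1) = φ (a, (d' a).1) := congrArg (fun v => v.1.2.1) (congrFun h a)
    exact (Prod.ext_iff.1 (φ.injective h1)).2
  · intro d a b hab
    refine ⟨fun h => hab.ne (σ.injective h), ?_⟩
    change (edgeBlowup H u w E).Adj (φ.symm (φ (a, (d a).1))) (φ.symm (φ (b, (d b).1)))
    rw [Equiv.symm_apply_apply, Equiv.symm_apply_apply]
    refine ⟨hF hab, ?_, ?_⟩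
    · rintro (rfl : a = u) (rfl : b = w)
      exact hE hab _ (d _).2 _ (d _).2
    · rintro (rfl : a = w) (rfl : b = u)
      exact hE hab.symm _ (d _).2 _ (d _).2

theorem partiteCount_subtuple_eq_zero (huw : H.Adj u w)
    (hE : ∀ x ∈ S u, ∀ y ∈ S w, ¬ E x y) :
    partiteCount H
      ((partiteGraph ((edgeBlowup H u w E).comap φ.symm) X).induce (subtuple φ X σ S))
      (restrictClasses (partiteClasses _ X) (subtuple φ X σ S)) = 0 := by
  refine partiteCount_eq_zero H _ _ σ.symm σ.symm.injective huw ?_ ?_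
  · rintro ⟨⟨i, x⟩, a, ha, hxa⟩ ⟨⟨j, y⟩, b, hb, hyb⟩ h
    have := h.2
    simp only at hxa hyb
    simp only [SimpleGraph.comap_adj, Function.Embedding.subtype_apply, hxa, hyb,
      Equiv.symm_apply_apply] at this
    exact this.1
  · rintro ⟨⟨i, x⟩, a, ha, hxa⟩ ⟨⟨j, y⟩, b, hb, hyb⟩ h hu hw
    have := h.2
    simp only at hxa hyb ha hb
    simp only [SimpleGraph.comap_adj, Function.Embedding.subtype_apply, hxa, hyb,
      Equiv.symm_apply_apply] at this
    have hu' : σ.symm i = u := hu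
    have hw' : σ.symm j = w := hw
    rw [hu'] at ha
    rw [hw'] at hb
    exact hE a ha b hb (this.2.1 hu' hw')

end Subtuple

theorem partiteCount_partiteGraph_le {k : ℕ} {W : Type*} [Finite W] (X : Fin k → Finset W)
    (F : SimpleGraph (Fin k)) (G : SimpleGraph W) :
    partiteCount F (partiteGraph G X) (partiteClasses G X) ≤ k ^ k * ∏ a, #(X a) := by
  refine (partiteCount_le _ _ _).trans (Nat.mul_le_mul_left _ (prod_le_prod' fun a _ => ?_))
  have hmem : ∀ v : {v // partiteClasses G X v = a}, ∃ x : X a, v.1.2.1 = x.1 := by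
    rintro ⟨⟨i, x⟩, rfl⟩
    exact ⟨x, rfl⟩
  choose g hg using hmem
  refine (Nat.card_le_card_of_injective g ?_).trans_eq (by simp)
  intro v v' h
  have h1 := (hg v).trans ((congrArg Subtype.val h).trans (hg v').symm)
  obtain ⟨⟨i, x⟩, rfl⟩ := v
  obtain ⟨⟨j, y⟩, hij⟩ := v'
  obtain rfl : j = i := hij
  have hxy : x = y := Subtype.ext h1
  subst hxy
  rfl

theorem lt_div_of_le_mul {ε K P m n : ℝ} (hε : 0 ≤ ε) (hK : 2 * ε * K < 1) (hP : 0 < P)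
    (hm : P ≤ m) (hn : P ≤ n) (hn' : n ≤ K * P) : 2 * ε < m / n := by
  rw [lt_div_iff₀ (hP.trans_le hn)]
  nlinarith [mul_le_mul_of_nonneg_left hn' hε]

/-- The subtuples `S` and `T` have coefficients `0` and more than `2 * ε`, which cannot both be
within `ε` of the coefficient of the whole tuple. -/
theorem not_isRegular {k : ℕ} {Ω W : Type*} [Finite W] (φ : Fin k × Ω ≃ W) (X : Fin k → Finset W)
    (σ : Fin k ≃ Fin k) {F H : SimpleGraph (Fin k)} (hF : F ≤ H) {u w : Fin k} (huw : H.Adj u w)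
    (hFuw : ¬ F.Adj u w) {E : Ω → Ω → Prop} {ε : ℝ} (hε : 0 < ε) (hk : 2 * ε * k ^ k < 1)
    (S T : Fin k → Finset Ω) (hS : ∀ a, ∀ x ∈ S a, φ (a, x) ∈ X (σ a))
    (hT : ∀ a, ∀ x ∈ T a, φ (a, x) ∈ X (σ a))
    (hSE : ∀ x ∈ S u, ∀ y ∈ S w, ¬ E x y) (hTE : ∀ x ∈ T u, ∀ y ∈ T w, E x y)
    (hScard : ε * (k ^ k * ∏ a, (#(X a) : ℝ)) ≤ ∏ a, (#(S a) : ℝ))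
    (hTcard : ε * (k ^ k * ∏ a, (#(X a) : ℝ)) ≤ ∏ a, (#(T a) : ℝ))
    (hT0 : 0 < ∏ a, (#(T a) : ℝ)) :
    ¬ IsRegular H F ε (partiteGraph ((edgeBlowup H u w E).comap φ.symm) X)
      (partiteClasses _ X) := by
  intro hreg
  set G := (edgeBlowup H u w E).comap φ.symm with hG
  have hall : (partiteCount F (partiteGraph G X) (partiteClasses G X) : ℝ) ≤
      k ^ k * ∏ a, (#(X a) : ℝ) := by
    exact_mod_cast partiteCount_partiteGraph_le X F G
  have hcond : ∀ R : Fin k → Finset Ω, (∀ a, ∀ x ∈ R a, φ (a, x) ∈ X (σ a)) →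
      ε * (k ^ k * ∏ a, (#(X a) : ℝ)) ≤ ∏ a, (#(R a) : ℝ) →
      ε * (partiteCount F (partiteGraph G X) (partiteClasses G X) : ℝ) ≤
        partiteCount F ((partiteGraph G X).induce (subtuple φ X σ R))
          (restrictClasses (partiteClasses G X) (subtuple φ X σ R)) := by
    intro R hR hRcard
    refine (mul_le_mul_of_nonneg_left hall hε.le).trans (hRcard.trans ?_)
    exact_mod_cast prod_card_le_partiteCount_subtuple (u := u) (w := w) (E := E) hF hR
      fun h => absurd h hFuw
  have h0 := hreg _ (hcond S hS hScard)
  have h1 := hreg _ (hcond T hT hTcard)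
  have c0 : coeff H F ((partiteGraph G X).induce (subtuple φ X σ S))
      (restrictClasses (partiteClasses G X) (subtuple φ X σ S)) = 0 := by
    rw [coeff, partiteCount_subtuple_eq_zero huw hSE, Nat.cast_zero, zero_div]
  have c1 : 2 * ε < coeff H F ((partiteGraph G X).induce (subtuple φ X σ T))
      (restrictClasses (partiteClasses G X) (subtuple φ X σ T)) := by
    have hH : (∏ a, #(T a) : ℝ) ≤ partiteCount H
        ((partiteGraph G X).induce (subtuple φ X σ T))
        (restrictClasses (partiteClasses G X) (subtuple φ X σ T)) := by
      exact_mod_cast prod_card_le_partiteCount_subtuple le_rfl hT fun _ => hTE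
    have hFlow : (∏ a, #(T a) : ℝ) ≤ partiteCount F
        ((partiteGraph G X).induce (subtuple φ X σ T))
        (restrictClasses (partiteClasses G X) (subtuple φ X σ T)) := by
      exact_mod_cast prod_card_le_partiteCount_subtuple (u := u) (w := w) (E := E) hF hT
        fun h => absurd h hFuw
    have hFup : (partiteCount F
        ((partiteGraph G X).induce (subtuple φ X σ T))
        (restrictClasses (partiteClasses G X) (subtuple φ X σ T)) : ℝ) ≤
          k ^ k * ∏ a, (#(T a) : ℝ) := by
      exact_mod_cast partiteCount_subtuple_le φ X σ T F G
    exact lt_div_of_le_mul hε.le hk hT0 hH hFlow hFup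
  rw [c0, abs_le] at h0
  rw [abs_le] at h1
  linarith [h0.1, h1.2]

/-! ### From regular partitions to few irregular pairs. -/

theorem copyCount_le_pow {k : ℕ} {W : Type*} [Fintype W] (G : SimpleGraph W)
    (H : SimpleGraph (Fin k)) : G.copyCount H ≤ Fintype.card W ^ k := by
  classical
  have : Finite (H.Copy G) := Finite.of_injective _ DFunLike.coe_injective
  rw [SimpleGraph.copyCount, ← Set.ncard_coe_finset, coe_filter_univ,
    ← SimpleGraph.Copy.range_toSubgraph, ← Set.image_univ]
  refine (Set.ncard_image_le (Set.toFinite _)).trans ?_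
  rw [Set.ncard_univ]
  refine (Nat.card_le_card_of_injective (DFunLike.coe : H.Copy G → Fin k → W)
    DFunLike.coe_injective).trans_eq ?_
  rw [Nat.card_pi, prod_const, card_univ, Fintype.card_fin, Nat.card_eq_fintype_card]

theorem prod_univ_eq_mul_mul {ι : Type*} [Fintype ι] [DecidableEq ι] {u w : ι} (huw : u ≠ w)
    (h : ι → ℝ) : ∏ a, h a = h u * h w * ∏ a ∈ (univ.erase u).erase w, h a := by
  rw [mul_assoc, mul_prod_erase _ _ (mem_erase.2 ⟨huw.symm, mem_univ w⟩),
    mul_prod_erase _ _ (mem_univ u)]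

-- Passes from the density of `Q` on transversals to that on pairs: exchanging the coordinates `u`,
-- `w` of a tuple with a given pair is injective.
open scoped Classical in
theorem card_pair_mul_le {ι Ω : Type*} [Fintype ι] [DecidableEq ι] [Fintype Ω] {u w : ι}
    (huw : u ≠ w) (Q : Ω → Ω → Prop) :
    #{q : Ω × Ω | Q q.1 q.2} * Fintype.card Ω ^ Fintype.card ι ≤
      #{ω : ι → Ω | Q (ω u) (ω w)} * Fintype.card Ω ^ 2 := by
  have h1 : Fintype.card Ω ^ Fintype.card ι = #(univ : Finset (ι → Ω)) := by simp
  have h2 : Fintype.card Ω ^ 2 = #(univ : Finset (Ω × Ω)) := by simp [sq]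
  rw [h1, h2, ← card_product, ← card_product]
  refine card_le_card_of_injOn (fun r => (Function.update (Function.update r.2 u r.1.1) w r.1.2,
    (r.2 u, r.2 w))) ?_ ?_
  · rintro ⟨⟨a, b⟩, ω⟩ hr
    simp only [coe_product, Set.mem_prod, coe_filter, mem_univ, true_and, Set.mem_ofPred_eq,
      coe_univ, Set.mem_univ, and_true] at hr ⊢
    simpa [Function.update_of_ne huw] using hr
  · rintro ⟨⟨a, b⟩, ω⟩ - ⟨⟨a', b'⟩, ω'⟩ - h
    simp only [Prod.mk.injEq] at h ⊢
    obtain ⟨h, hu, hw⟩ := h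
    have e := congrFun h
    refine ⟨⟨?_, ?_⟩, funext fun c => ?_⟩
    · simpa [Function.update_of_ne huw] using e u
    · simpa using e w
    · by_cases hcw : c = w
      · rw [hcw, hw]
      by_cases hcu : c = u
      · rw [hcu, hu]
      simpa [Function.update_of_ne hcw, Function.update_of_ne hcu] using e c

theorem sum_div_card_cell {α Λ : Type*} [Fintype α] [DecidableEq Λ] (f : α → Λ) (c : Λ → ℝ) :
    ∑ x, c (f x) / #(cell f x) = ∑ z ∈ univ.image f, c z := by
  rw [← sum_fiberwise_of_maps_to (t := univ.image f) (g := f) (by simp)]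
  refine sum_congr rfl fun z hz => ?_
  obtain ⟨x, -, rfl⟩ := mem_image.1 hz
  rw [sum_congr rfl (g := fun _ => c (f x) / #(cell f x)), sum_const, nsmul_eq_mul]
  · have : (0 : ℝ) < #(cell f x) := by exact_mod_cast card_cell_pos f x
    have e : #{i | f i = f x} = #(cell f x) :=
      congrArg card (by ext; simp [mem_cell])
    rw [e]
    field_simp
  · intro y hy
    have hy' := (mem_filter.1 hy).2
    rw [hy', cell_congr hy']

section Reduction

variable {k : ℕ} {ι Θ W : Type*} [Fintype W] [DecidableEq W]
  (φ : Fin k × (ι × Θ) ≃ W) (P : Finpartition (univ : Finset W)) (u w : Fin k)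

open scoped Classical in
/-- The part of the vertex `(a, ω)`, together with the index of `ω` if `a` is one of `u`, `w`. -/
noncomputable def vertexLabel (a : Fin k) (ω : ι × Θ) : Option ι × Finset W :=
  (if a = u ∨ a = w then some ω.1 else none, P.part (φ (a, ω)))

variable {φ P u w} in
theorem vertexLabel_left_eq {ω ω' : ι × Θ}
    (h : vertexLabel φ P u w u ω = vertexLabel φ P u w u ω') :
    ω.1 = ω'.1 ∧ P.part (φ (u, ω)) = P.part (φ (u, ω')) := by
  simpa [vertexLabel] using h

variable {φ P u w} in
theorem vertexLabel_right_eq {ω ω' : ι × Θ}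
    (h : vertexLabel φ P u w w ω = vertexLabel φ P u w w ω') :
    ω.1 = ω'.1 ∧ P.part (φ (w, ω)) = P.part (φ (w, ω')) := by
  simpa [vertexLabel] using h

variable [Fintype ι] [Fintype Θ]

/-- A part may meet several classes and indices of the blow-up, and then a cell is only a fraction
of it. On average the loss is bounded, since each label contributes the size of its part once. -/
theorem sum_card_part_div_card_cell_le (a : Fin k) :
    ∑ ω, (#(P.part (φ (a, ω))) : ℝ) / #(cell (vertexLabel φ P u w a) ω) ≤
      (if a = u ∨ a = w then (Fintype.card ι : ℝ) else 1) * Fintype.card W := by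
  classical
  refine (sum_div_card_cell (vertexLabel φ P u w a) fun z => (#z.2 : ℝ)).trans_le ?_
  set t : Finset (Option ι) := if a = u ∨ a = w then univ.image some else {none} with ht
  have hsub : univ.image (vertexLabel φ P u w a) ⊆ t ×ˢ P.parts := by
    intro z hz
    obtain ⟨ω, -, rfl⟩ := mem_image.1 hz
    refine mem_product.2 ⟨?_, P.part_mem.2 (mem_univ _)⟩
    simp only [vertexLabel, ht]
    split_ifs <;> simp
  refine (sum_le_sum_of_subset_of_nonneg hsub
    fun z _ _ => Nat.cast_nonneg (α := ℝ) #z.2).trans_eq ?_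
  rw [sum_product]
  simp only [sum_const, nsmul_eq_mul]
  congr 1
  · rw [ht]
    split_ifs
    · rw [card_image_of_injective _ (Option.some_injective _), card_univ]
    · simp
  · rw [← card_univ, ← P.sum_card_parts]
    push_cast
    rfl

theorem sum_prod_card_part_div_le [Nonempty ι] :
    ∑ ω : Fin k → ι × Θ, ∏ a, (#(P.part (φ (a, ω a))) : ℝ) / #(cell (vertexLabel φ P u w a) (ω a)) ≤
      Fintype.card ι ^ 2 * Fintype.card W ^ k := by
  classical
  have h := prod_univ_sum (fun _ : Fin k => (univ : Finset (ι × Θ)))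
    fun a ω => (#(P.part (φ (a, ω))) : ℝ) / #(cell (vertexLabel φ P u w a) ω)
  rw [Fintype.piFinset_univ] at h
  rw [← h]
  refine (prod_le_prod (fun a _ => sum_nonneg fun _ _ => by positivity)
    fun a _ => sum_card_part_div_card_cell_le φ P u w a).trans ?_
  rw [prod_mul_distrib, prod_const, card_univ, Fintype.card_fin, prod_ite, prod_const, prod_const,
    one_pow, mul_one]
  refine mul_le_mul_of_nonneg_right (pow_le_pow_right₀ (Nat.one_le_cast.2 Fintype.card_pos) ?_)
    (by positivity)
  refine (card_le_card (t := {u, w}) fun a ha => ?_).trans card_le_two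
  simpa using ha

variable {φ P u w}

theorem cell_vertexLabel {a : Fin k} (ha : a = u ∨ a = w) (ω : ι × Θ) :
    cell (vertexLabel φ P u w a) ω =
      ({ω.1} : Finset ι) ×ˢ cell (fun x => P.part (φ (a, (ω.1, x)))) ω.2 := by
  ext ⟨i, x⟩
  simp only [mem_cell, vertexLabel, ha, if_true, Prod.mk.injEq, Option.some.injEq, mem_product,
    mem_singleton]
  constructor
  · rintro ⟨rfl, h⟩
    exact ⟨rfl, h⟩
  · rintro ⟨rfl, h⟩
    exact ⟨rfl, h⟩

/-- Rectangles in the classes `u`, `w` extend to subtuples of the same relative size. -/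
theorem exists_subtuple (huw : u ≠ w) {δ : ℝ} (ω : Fin k → ι × Θ)
    {S T : Finset Θ} (hS : S ⊆ cell (fun x => P.part (φ (u, ((ω u).1, x)))) (ω u).2)
    (hT : T ⊆ cell (fun x => P.part (φ (w, ((ω w).1, x)))) (ω w).2)
    (hST : δ * (#(cell (fun x => P.part (φ (u, ((ω u).1, x)))) (ω u).2) *
      #(cell (fun x => P.part (φ (w, ((ω w).1, x)))) (ω w).2)) ≤ #S * #T) :
    ∃ R : Fin k → Finset (ι × Θ), (∀ a, R a ⊆ cell (vertexLabel φ P u w a) (ω a)) ∧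
      δ * ∏ a, (#(cell (vertexLabel φ P u w a) (ω a)) : ℝ) ≤ ∏ a, (#(R a) : ℝ) ∧
      R u = {(ω u).1} ×ˢ S ∧ R w = {(ω w).1} ×ˢ T := by
  classical
  set R : Fin k → Finset (ι × Θ) := Function.update (Function.update
    (fun a => cell (vertexLabel φ P u w a) (ω a)) u ({(ω u).1} ×ˢ S)) w ({(ω w).1} ×ˢ T) with hR
  have hRu : R u = {(ω u).1} ×ˢ S := by simp [hR, Function.update_of_ne huw]
  have hRw : R w = {(ω w).1} ×ˢ T := by simp [hR]
  have hRa : ∀ a, a ≠ u → a ≠ w → R a = cell (vertexLabel φ P u w a) (ω a) := fun a h1 h2 => by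
    simp [hR, Function.update_of_ne h1, Function.update_of_ne h2]
  refine ⟨R, fun a => ?_, ?_, hRu, hRw⟩
  · by_cases hau : a = u
    · rw [hau, hRu, cell_vertexLabel (Or.inl rfl)]
      exact product_subset_product_right hS
    by_cases haw : a = w
    · rw [haw, hRw, cell_vertexLabel (Or.inr rfl)]
      exact product_subset_product_right hT
    rw [hRa a hau haw]
  · rw [prod_univ_eq_mul_mul huw, prod_univ_eq_mul_mul huw, hRu, hRw,
      cell_vertexLabel (Or.inl rfl), cell_vertexLabel (Or.inr rfl), ← mul_assoc,
      prod_congr (g := fun a => (#(cell (vertexLabel φ P u w a) (ω a)) : ℝ))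
        (f := fun a => (#(R a) : ℝ)) rfl fun a ha => by
          rw [hRa a (mem_erase.1 (mem_erase.1 ha).2).1 (mem_erase.1 ha).1]]
    refine mul_le_mul_of_nonneg_right ?_ (prod_nonneg fun _ _ => Nat.cast_nonneg _)
    simpa only [card_product, card_singleton, one_mul] using hST

end Reduction

/-- The copy of `H` in a blow-up on a transversal. -/
def transversalCopy {k : ℕ} {Ω W : Type*} (φ : Fin k × Ω ≃ W) {H : SimpleGraph (Fin k)}
    {u w : Fin k} {R : Ω → Ω → Prop} (ω : Fin k → Ω) (h : R (ω u) (ω w)) :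
    H.Copy ((edgeBlowup H u w R).comap φ.symm) where
  toHom := ⟨fun a => φ (a, ω a), fun {a b} hab => by
    rw [SimpleGraph.comap_adj, Equiv.symm_apply_apply, Equiv.symm_apply_apply]
    refine ⟨hab, ?_, ?_⟩
    · rintro (rfl : a = u) (rfl : b = w)
      exact h
    · rintro (rfl : a = w) (rfl : b = u)
      exact h⟩
  injective' a b hab := (Prod.ext_iff.1 (φ.injective hab)).1

theorem transversalCopy_verts {k : ℕ} {Ω W : Type*} (φ : Fin k × Ω ≃ W) {H : SimpleGraph (Fin k)}
    {u w : Fin k} {R : Ω → Ω → Prop} (ω : Fin k → Ω) (h : R (ω u) (ω w)) :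
    (transversalCopy φ (H := H) ω h).toSubgraph.verts = Set.range fun a => φ (a, ω a) :=
  toSubgraph_verts _

theorem mul_card_le_of_fiberwise {α Λ : Type*} [DecidableEq Λ] (f : α → Λ) {A B : Finset α}
    (hBA : B ⊆ A) {δ : ℝ} (h : ∀ x ∈ A, δ * #{y ∈ A | f y = f x} ≤ #{y ∈ B | f y = f x}) :
    δ * #A ≤ #B := by
  rw [card_eq_sum_card_fiberwise (f := f) (s := A) (t := A.image f)
      fun x hx => mem_image_of_mem f hx,
    card_eq_sum_card_fiberwise (f := f) (s := B) (t := A.image f)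
      fun x hx => mem_image_of_mem f (hBA hx), Nat.cast_sum, Nat.cast_sum, mul_sum]
  refine sum_le_sum fun z hz => ?_
  obtain ⟨x, hx, rfl⟩ := mem_image.1 hz
  exact h x hx

/-- In a regular partition of a blow-up, the traces on the classes `u` and `w` have few irregular
pairs. -/
theorem sum_irregularCount_le {k : ℕ} {ι Θ W : Type*} [Fintype ι] [Nonempty ι] [Fintype Θ]
    [Nonempty Θ] [Fintype W] [DecidableEq W] (φ : Fin k × (ι × Θ) ≃ W) {F H : SimpleGraph (Fin k)}
    (hF : F ≤ H) {u w : Fin k} (huw : H.Adj u w) (hFuw : ¬ F.Adj u w) (E : ι → ι → Θ → Θ → Prop)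
    {ε δ M : ℝ} (hε : 0 < ε) (hδ : 0 < δ) (hM : 0 < M) (hk : 2 * ε * k ^ k < 1)
    (hεM : ε * k ^ k * M ≤ δ) (P : Finpartition (univ : Finset W))
    (hP : IsRegularPartition H F ε
      ((edgeBlowup H u w fun ω ω' => E ω.1 ω'.1 ω.2 ω'.2).comap φ.symm) P) :
    (∑ i, ∑ j, irregularCount (E i j) (fun x => P.part (φ (u, (i, x))))
        (fun y => P.part (φ (w, (j, y)))) δ : ℝ) ≤
      (Fintype.card ι * Fintype.card Θ) ^ 2 * (k ^ k * (ε / δ + Fintype.card ι ^ 2 / M)) := by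
  classical
  set R : ι × Θ → ι × Θ → Prop := fun ω ω' => E ω.1 ω'.1 ω.2 ω'.2 with hR
  set G := (edgeBlowup H u w R).comap φ.symm with hG
  set Q : ι × Θ → ι × Θ → Prop := fun ω ω' => IrregularPair (E ω.1 ω'.1)
    (fun x => P.part (φ (u, (ω.1, x)))) (fun y => P.part (φ (w, (ω'.1, y)))) δ ω.2 ω'.2 with hQ
  set lab := vertexLabel φ P u w with hlab
  set r : (Fin k → ι × Θ) → ℝ := fun ω => ∏ a, (#(P.part (φ (a, ω a))) : ℝ) / #(cell (lab a) (ω a))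
    with hr
  -- The bound on `r` keeps the cells, and thus the rectangles in them, a large enough share of
  -- their parts.
  set bad : Finset (Fin k → ι × Θ) := {ω | Q (ω u) (ω w) ∧ r ω ≤ M} with hbad
  have hcellpos : ∀ ω : Fin k → ι × Θ, 0 < ∏ a, (#(cell (lab a) (ω a)) : ℝ) := fun ω =>
    prod_pos fun a _ => by exact_mod_cast card_cell_pos _ _
  have hcongr : ∀ ω ω' : Fin k → ι × Θ,
      (∀ a, lab a (ω a) = lab a (ω' a)) → (ω ∈ bad ↔ ω' ∈ bad) := by
    intro ω ω' h
    have hq : Q (ω u) (ω w) ↔ Q (ω' u) (ω' w) := by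
      obtain ⟨h1, h2⟩ := vertexLabel_left_eq (h u)
      obtain ⟨h3, h4⟩ := vertexLabel_right_eq (h w)
      simp only [hQ]
      rw [h1, h3]
      refine IrregularPair.congr ?_ ?_
      · have e : ((ω' u).1, (ω u).2) = ω u := Prod.ext h1.symm rfl
        exact (congrArg (fun z => P.part (φ (u, z))) e).trans h2
      · have e : ((ω' w).1, (ω w).2) = ω w := Prod.ext h3.symm rfl
        exact (congrArg (fun z => P.part (φ (w, z))) e).trans h4
    have hrr : r ω = r ω' := by
      refine prod_congr rfl fun a _ => ?_
      rw [cell_congr (h a), show P.part (φ (a, ω a)) = P.part (φ (a, ω' a)) from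
        congrArg Prod.snd (h a)]
    simp only [hbad, mem_filter, mem_univ, true_and, hq, hrr]
  -- the rectangles of an irregular pair, extended to all classes
  have hempty : ∀ ω ∈ bad, ∃ S : Fin k → Finset (ι × Θ), (∀ a, S a ⊆ cell (lab a) (ω a)) ∧
      δ * ∏ a, (#(cell (lab a) (ω a)) : ℝ) ≤ ∏ a, (#(S a) : ℝ) ∧
      ∀ x ∈ S u, ∀ y ∈ S w, ¬ R x y := by
    intro ω hω
    obtain ⟨⟨S, hS, T, hT, hST, hE⟩, -⟩ := (mem_filter.1 hω).2.1
    obtain ⟨A, hA, hcard, hu, hw⟩ := exists_subtuple huw.ne ω hS hT hST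
    refine ⟨A, hA, hcard, ?_⟩
    rw [hu, hw]
    rintro ⟨i, x⟩ hx ⟨j, y⟩ hy
    simp only [mem_product, mem_singleton] at hx hy
    obtain ⟨rfl, hx⟩ := hx
    obtain ⟨rfl, hy⟩ := hy
    exact hE x hx y hy
  have hfull : ∀ ω ∈ bad, ∃ S : Fin k → Finset (ι × Θ), (∀ a, S a ⊆ cell (lab a) (ω a)) ∧
      δ * ∏ a, (#(cell (lab a) (ω a)) : ℝ) ≤ ∏ a, (#(S a) : ℝ) ∧
      ∀ x ∈ S u, ∀ y ∈ S w, R x y := by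
    intro ω hω
    obtain ⟨-, ⟨S, hS, T, hT, hST, hE⟩⟩ := (mem_filter.1 hω).2.1
    obtain ⟨A, hA, hcard, hu, hw⟩ := exists_subtuple huw.ne ω hS hT hST
    refine ⟨A, hA, hcard, ?_⟩
    rw [hu, hw]
    rintro ⟨i, x⟩ hx ⟨j, y⟩ hy
    simp only [mem_product, mem_singleton] at hx hy
    obtain ⟨rfl, hx⟩ := hx
    obtain ⟨rfl, hy⟩ := hy
    exact hE x hx y hy
  set badE : Finset (Fin k → ι × Θ) := {ω ∈ bad | R (ω u) (ω w)} with hbadE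
  -- By `hcongr`, `bad` is a union of label classes; in each of them the full rectangles supply a
  -- proportion `δ` of transversals that span copies of `H`.
  have hfib : δ * #bad ≤ #badE := by
    refine mul_card_le_of_fiberwise (fun ω a => lab a (ω a)) (filter_subset _ _) fun ω hω => ?_
    obtain ⟨S, hS, hcard, hSR⟩ := hfull ω hω
    have h1 : (#{ω' ∈ bad | (fun a => lab a (ω' a)) = fun a => lab a (ω a)} : ℝ) ≤
        ∏ a, (#(cell (lab a) (ω a)) : ℝ) := by
      rw [← Nat.cast_prod, ← Fintype.card_piFinset]
      refine Nat.cast_le.2 (card_le_card fun ω' hω' => Fintype.mem_piFinset.2 fun a => ?_)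
      exact mem_cell.2 (congrFun (mem_filter.1 hω').2 a)
    have h2 : ∏ a, (#(S a) : ℝ) ≤
        #{ω' ∈ badE | (fun a => lab a (ω' a)) = fun a => lab a (ω a)} := by
      rw [← Nat.cast_prod, ← Fintype.card_piFinset]
      refine Nat.cast_le.2 (card_le_card fun ω' hω' => ?_)
      have hm := Fintype.mem_piFinset.1 hω'
      have hl : ∀ a, lab a (ω' a) = lab a (ω a) := fun a => mem_cell.1 (hS a (hm a))
      exact mem_filter.2 ⟨mem_filter.2 ⟨(hcongr ω' ω hl).2 hω, hSR _ (hm u) _ (hm w)⟩, funext hl⟩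
    exact (mul_le_mul_of_nonneg_left h1 hδ.le).trans (hcard.trans h2)
  have hcopies : (#badE : ℝ) ≤ ε * Fintype.card W ^ k := by
    have hle : #badE ≤ Set.ncard {K : G.Subgraph | Nonempty (H ≃g K.coe) ∧
        ¬ ∃ X : Fin k → Finset W, (∀ i, X i ∈ P.parts) ∧ LiesIn K X ∧
          IsRegular H F ε (partiteGraph G X) (partiteClasses G X)} := by
      rw [← Fintype.card_coe, ← Nat.card_eq_fintype_card, ← Set.ncard_univ]
      refine Set.ncard_le_ncard_of_injOn
        (fun ω : badE => (transversalCopy φ (H := H) ω.1 (mem_filter.1 ω.2).2).toSubgraph) ?_ ?_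
        (Set.toFinite _)
      · rintro ⟨ω, hω⟩ -
        refine ⟨⟨SimpleGraph.Copy.isoToSubgraph _⟩, ?_⟩
        rintro ⟨X, hX, ⟨f, hf⟩, hreg⟩
        have hωbad := (mem_filter.1 hω).1
        obtain ⟨S, hS, hScard, hSR⟩ := hempty ω hωbad
        obtain ⟨T, hT, hTcard, hTR⟩ := hfull ω hωbad
        have hv := transversalCopy_verts φ (H := H) ω (mem_filter.1 hω).2
        have hmem : ∀ a, φ (a, ω a) ∈
            (transversalCopy φ (H := H) ω (mem_filter.1 hω).2).toSubgraph.verts := fun a => by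
          rw [hv]; exact ⟨a, rfl⟩
        -- The order in which the tuple `X` lists the parts of the copy is arbitrary; `σ₀ a` is the
        -- position serving the vertex in class `a`.
        let σ₀ : Fin k → Fin k := fun a => f.symm ⟨φ (a, ω a), hmem a⟩
        have hσ₀ : Function.Injective σ₀ := fun a b hab => by
          have h1 := f.symm.injective hab
          exact (Prod.ext_iff.1 (φ.injective (congrArg Subtype.val h1))).1
        let σ : Fin k ≃ Fin k := Equiv.ofBijective σ₀ (Finite.injective_iff_bijective.1 hσ₀)
        have hXσ : ∀ a, X (σ a) = P.part (φ (a, ω a)) := fun a => by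
          refine (P.part_eq_of_mem (hX _) ?_).symm
          have := hf (σ a)
          have e : f (σ a) = ⟨φ (a, ω a), hmem a⟩ := f.apply_symm_apply _
          rwa [e] at this
        have hXprod : ∏ a, (#(X a) : ℝ) = ∏ a, (#(P.part (φ (a, ω a))) : ℝ) := by
          rw [← Equiv.prod_comp σ]
          exact prod_congr rfl fun a _ => by rw [hXσ]
        have hsub : ∀ A : Fin k → Finset (ι × Θ), (∀ a, A a ⊆ cell (lab a) (ω a)) →
            ∀ a, ∀ x ∈ A a, φ (a, x) ∈ X (σ a) := by
          intro A hA a x hx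
          have h1 : P.part (φ (a, x)) = P.part (φ (a, ω a)) :=
            congrArg Prod.snd (mem_cell.1 (hA a hx))
          rw [hXσ, ← h1]
          exact P.mem_part (mem_univ _)
        have hbig : ε * (k ^ k * ∏ a, (#(X a) : ℝ)) ≤ δ * ∏ a, (#(cell (lab a) (ω a)) : ℝ) := by
          have hrM : r ω ≤ M := (mem_filter.1 hωbad).2.2
          simp only [hr, prod_div_distrib] at hrM
          rw [div_le_iff₀ (hcellpos ω)] at hrM
          rw [hXprod]
          calc _ ≤ ε * (k ^ k * (M * ∏ a, (#(cell (lab a) (ω a)) : ℝ))) := by gcongr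
            _ = (ε * k ^ k * M) * ∏ a, (#(cell (lab a) (ω a)) : ℝ) := by ring
            _ ≤ _ := mul_le_mul_of_nonneg_right hεM (hcellpos ω).le
        exact not_isRegular φ X σ hF huw hFuw hε hk S T (hsub S hS) (hsub T hT) hSR hTR
          (hbig.trans hScard) (hbig.trans hTcard)
          ((mul_pos hδ (hcellpos ω)).trans_le hTcard) hreg
      · rintro ⟨ω, hω⟩ - ⟨ω', hω'⟩ - h
        have hv := congrArg SimpleGraph.Subgraph.verts h
        simp only [transversalCopy_verts] at hv
        refine Subtype.ext (funext fun a => ?_)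
        obtain ⟨b, hb⟩ : φ (a, ω a) ∈ Set.range fun a => φ (a, ω' a) := hv ▸ ⟨a, rfl⟩
        have hb' := Prod.ext_iff.1 (φ.injective hb)
        obtain rfl : b = a := hb'.1
        exact hb'.2.symm
    calc (#badE : ℝ) ≤ _ := Nat.cast_le.2 hle
      _ ≤ ε * G.copyCount H := hP
      _ ≤ ε * Fintype.card W ^ k := by
        gcongr
        exact_mod_cast copyCount_le_pow G H
  -- Markov's inequality for `r`.
  have hlarge : M * #{ω : Fin k → ι × Θ | ¬ r ω ≤ M} ≤
      (Fintype.card ι : ℝ) ^ 2 * Fintype.card W ^ k := by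
    refine le_trans ?_ (sum_prod_card_part_div_le φ P u w)
    rw [mul_comm, ← nsmul_eq_mul, ← sum_const]
    refine (sum_le_sum fun ω hω => ?_).trans
      (sum_le_univ_sum_of_nonneg fun ω => prod_nonneg fun _ _ => by positivity)
    exact (not_le.1 (mem_filter.1 hω).2).le
  have hsplit : #{ω : Fin k → ι × Θ | Q (ω u) (ω w)} ≤
      #bad + #{ω : Fin k → ι × Θ | ¬ r ω ≤ M} := by
    refine (card_le_card fun ω hω => ?_).trans (card_union_le _ _)
    simp only [hbad, mem_union, mem_filter, mem_univ, true_and] at hω ⊢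
    tauto
  have hirr : (∑ i, ∑ j, irregularCount (E i j) (fun x => P.part (φ (u, (i, x))))
        (fun y => P.part (φ (w, (j, y)))) δ : ℝ) = #{q : (ι × Θ) × (ι × Θ) | Q q.1 q.2} := by
    simp only [irregularCount, card_filter, hQ, Fintype.sum_prod_type, Nat.cast_sum]
    exact sum_congr rfl fun i _ => by rw [sum_comm]
  have hW : (Fintype.card W : ℝ) ^ k = k ^ k * Fintype.card (ι × Θ) ^ k := by
    rw [← mul_pow, ← Nat.cast_mul, ← Fintype.card_congr φ, Fintype.card_prod, Fintype.card_fin]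
  have hpair : (#{q : (ι × Θ) × (ι × Θ) | Q q.1 q.2} : ℝ) * Fintype.card (ι × Θ) ^ k ≤
      #{ω : Fin k → ι × Θ | Q (ω u) (ω w)} * Fintype.card (ι × Θ) ^ 2 := by
    have := card_pair_mul_le huw.ne Q
    rw [Fintype.card_fin] at this
    exact_mod_cast this
  have hcardpos : (0 : ℝ) < Fintype.card (ι × Θ) := by exact_mod_cast Fintype.card_pos
  have hcardeq : (Fintype.card ι * Fintype.card Θ : ℝ) = Fintype.card (ι × Θ) := by
    rw [Fintype.card_prod, Nat.cast_mul]
  have hbound : (#{ω : Fin k → ι × Θ | Q (ω u) (ω w)} : ℝ) ≤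
      (k ^ k * Fintype.card (ι × Θ) ^ k) * (ε / δ + Fintype.card ι ^ 2 / M) := by
    have h1 : (#bad : ℝ) ≤ ε * (k ^ k * Fintype.card (ι × Θ) ^ k) / δ := by
      rw [le_div_iff₀ hδ, ← hW]
      linarith
    have h2 : (#{ω : Fin k → ι × Θ | ¬ r ω ≤ M} : ℝ) ≤
        Fintype.card ι ^ 2 * (k ^ k * Fintype.card (ι × Θ) ^ k) / M := by
      rw [le_div_iff₀ hM, ← hW]
      linarith
    calc (#{ω : Fin k → ι × Θ | Q (ω u) (ω w)} : ℝ)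
        ≤ #bad + #{ω : Fin k → ι × Θ | ¬ r ω ≤ M} := by exact_mod_cast hsplit
      _ ≤ _ := add_le_add h1 h2
      _ = _ := by ring
  rw [hirr, hcardeq]
  refine le_of_mul_le_mul_right (hpair.trans ?_) (pow_pos hcardpos k)
  calc _ ≤ (k ^ k * Fintype.card (ι × Θ) ^ k) * (ε / δ + Fintype.card ι ^ 2 / M) *
        (Fintype.card (ι × Θ) : ℝ) ^ 2 := by gcongr
    _ = _ := by ring

/-! ### Choice of the parameters. -/

theorem exists_adj_not_adj {V : Type*} {F H : SimpleGraph V} (h : F < H) :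
    ∃ u w, H.Adj u w ∧ ¬ F.Adj u w := by
  by_contra! hcon
  exact h.not_ge fun u w => hcon u w

/-- The regularity parameter is small enough for a prime of the size of the tower height. -/
theorem mul_pow_mul_sq_le_one {ε K m p : ℝ} (hε : 0 < ε) (hK : 4 ≤ K) (hm : 1 ≤ m) (hp : 0 ≤ p)
    (hpm : p ≤ 2 ^ 21 * m) (h : m ≤ 1 / (ε ^ (1 / 7 : ℝ) * K ^ (11 : ℝ))) :
    2 * p ^ 7 * K ^ 2 * ε ≤ 1 := by
  have hroot : (ε ^ (1 / 7 : ℝ)) ^ 7 = ε := by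
    rw [← Real.rpow_natCast, ← Real.rpow_mul hε.le]
    norm_num
  have hεpos : 0 < ε ^ (1 / 7 : ℝ) := Real.rpow_pos_of_pos hε _
  have hK11 : K ^ (11 : ℝ) = K ^ 11 := by exact_mod_cast Real.rpow_natCast K 11
  rw [hK11, le_div_iff₀ (by positivity)] at h
  have h7 : m ^ 7 * (ε * K ^ 77) ≤ 1 := by
    have := pow_le_one₀ (n := 7) (by positivity) h
    rw [mul_pow, mul_pow, hroot, ← pow_mul] at this
    exact this
  -- Here `148 = 1 + 7 * 21` and `75 = 7 * 11 - 2`: the exponent `11` of `K` pays for all numerical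
  -- constants.
  have h148 : (2 : ℝ) ^ 148 ≤ K ^ 75 := by
    calc (2 : ℝ) ^ 148 ≤ 4 ^ 75 := by norm_num
      _ ≤ K ^ 75 := by gcongr
  calc 2 * p ^ 7 * K ^ 2 * ε ≤ 2 * (2 ^ 21 * m) ^ 7 * K ^ 2 * ε := by gcongr
    _ = 2 ^ 148 * (m ^ 7 * K ^ 2 * ε) := by ring
    _ ≤ K ^ 75 * (m ^ 7 * K ^ 2 * ε) := by gcongr
    _ = m ^ 7 * (ε * K ^ 77) := by ring
    _ ≤ 1 := h7

/-- With `δ = 1 / p` and `K = k ^ k`, the choice `M = 2 * p ^ 6 * K` makes the tuples with large `r`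
contribute a fraction `1 / (2 * p ^ 2)`, half of what `exists_many_labels` allows. The requirement
`ε * K * M ≤ δ` is then exactly `hsmall`, whence the seventh power. -/
theorem exists_graph_twr_le {k : ℕ} {F H : SimpleGraph (Fin k)} (hFH : F < H) {ε : ℝ} (hε : 0 < ε)
    {m p : ℕ} [Fact p.Prime] (hpm : 442368 * (m + 1) ≤ p)
    (hsmall : 2 * (p : ℝ) ^ 7 * ((k : ℝ) ^ k) ^ 2 * ε ≤ 1) :
    ∃ (n : ℕ) (G : SimpleGraph (Fin n)), ∀ P : Finpartition (univ : Finset (Fin n)),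
      IsRegularPartition H F ε G P → twr m ≤ #P.parts := by
  classical
  obtain ⟨u, w, huw, hFuw⟩ := exists_adj_not_adj hFH
  set N := radix (m + 1) with hN
  have : NeZero N := ⟨(radix_pos _).ne'⟩
  let φ := Fintype.equivFin (Fin k × ((ZMod p × ZMod p) × Fin N))
  refine ⟨_, (edgeBlowup H u w fun ω ω' => towerRel ω.1 ω'.1 ω.2 ω'.2).comap φ.symm,
    fun P hP => ?_⟩
  have hp1 : (1 : ℝ) ≤ p := by exact_mod_cast (Fact.out : p.Prime).one_le
  have hp2 : (1 : ℝ) < p := by exact_mod_cast (Fact.out : p.Prime).one_lt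
  have hp0 : (0 : ℝ) < p := by linarith
  set K : ℝ := (k : ℝ) ^ k with hK
  have hK1 : 1 ≤ K := one_le_pow₀ (by exact_mod_cast Fin.pos u)
  have hK0 : 0 < K := by linarith
  have hk : 2 * ε * K < 1 := by
    have h1 : 2 * ε * K * 1 < 2 * ε * K * (p ^ 7 * K) := by
      gcongr
      nlinarith [one_lt_pow₀ hp2 (n := 7) (by norm_num)]
    linarith
  have hM : ε * K * (2 * p ^ 6 * K) ≤ 1 / p := by
    rw [le_div_iff₀ hp0]
    linarith
  have hsum := sum_irregularCount_le φ hFH.le huw hFuw towerRel hε (δ := 1 / p)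
    (M := 2 * p ^ 6 * K) (by positivity) (by positivity) hk hM P hP
  have hbound : ((Fintype.card (ZMod p × ZMod p) : ℝ) * Fintype.card (Fin N)) ^ 2 *
      (K * (ε / (1 / p) + (Fintype.card (ZMod p × ZMod p) : ℝ) ^ 2 / (2 * p ^ 6 * K))) ≤
      p ^ 2 * N ^ 2 := by
    rw [Fintype.card_prod, ZMod.card, Fintype.card_fin]
    push_cast
    have h1 : 2 * (p : ℝ) ^ 3 * K * ε ≤ 1 := by
      refine le_trans ?_ hsmall
      gcongr ?_ * ε
      have h2 : (p : ℝ) ^ 3 ≤ p ^ 7 := pow_le_pow_right₀ hp1 (by norm_num)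
      have h3 : K ≤ K ^ 2 := le_self_pow₀ hK1 (by norm_num)
      gcongr
    have e : ((p * p : ℝ) * N) ^ 2 * (K * (ε / (1 / p) + (p * p : ℝ) ^ 2 / (2 * p ^ 6 * K))) =
        p ^ 2 * N ^ 2 * ((2 * (p : ℝ) ^ 3 * K * ε + 1) / 2) := by
      field_simp
    rw [e]
    refine mul_le_of_le_one_right (by positivity) ?_
    linarith
  obtain ⟨i, hi⟩ := exists_many_labels hN hpm (fun i x => P.part (φ (u, (i, x))))
    (fun j y => P.part (φ (w, (j, y)))) (hsum.trans hbound)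
  have himage : #(univ.image fun x => P.part (φ (u, (i, x)))) ≤ #P.parts := by
    refine card_le_card fun X hX => ?_
    obtain ⟨x, -, rfl⟩ := mem_image.1 hX
    exact P.part_mem.2 (mem_univ _)
  have := two_mul_twr_le_radix m
  omega

end HFRegularity

theorem theorem1 :
    ∃ a b : ℝ, 0 < a ∧ 0 < b ∧
      ∀ (k : ℕ) (F H : SimpleGraph (Fin k)), F < H →
        ∀ ε : ℝ, 0 < ε →
          ∃ (n : ℕ) (G : SimpleGraph (Fin n)),
            ∀ P : Finpartition (Finset.univ : Finset (Fin n)),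
              HFRegularity.IsRegularPartition H F ε G P →
                twr ⌊1 / (ε ^ a * ((k : ℝ) ^ k) ^ b)⌋₊ ≤ P.parts.card := by
  refine ⟨1 / 7, 11, by norm_num, by norm_num, fun k F H hFH ε hε => ?_⟩
  obtain ⟨u, w, huw, -⟩ := HFRegularity.exists_adj_not_adj hFH
  have hk : 2 ≤ k := by
    by_contra! hk
    exact huw.ne (Fin.ext (by omega))
  have hK : (4 : ℝ) ≤ (k : ℝ) ^ k := by
    have : 2 ^ 2 ≤ k ^ k := (Nat.pow_le_pow_left hk 2).trans (Nat.pow_le_pow_right (by omega) hk)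
    exact_mod_cast this
  set m := ⌊1 / (ε ^ (1 / 7 : ℝ) * ((k : ℝ) ^ k) ^ (11 : ℝ))⌋₊ with hm
  rcases Nat.eq_zero_or_pos m with hm0 | hm0
  -- Height `0` asks for a single part only, so one vertex suffices.
  · refine ⟨1, ⊥, fun P _ => ?_⟩
    rw [hm0]
    exact card_pos.2 (P.parts_nonempty univ_nonempty.ne_empty)
  obtain ⟨p, hp, hlt, hle⟩ := Nat.exists_prime_lt_and_le_two_mul (442368 * (m + 1)) (by omega)
  have : Fact p.Prime := ⟨hp⟩
  refine HFRegularity.exists_graph_twr_le hFH hε hlt.le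
    (HFRegularity.mul_pow_mul_sq_le_one hε hK (m := m) (by exact_mod_cast hm0)
      (by positivity) ?_ ?_)
  -- As `m ≥ 1`, Bertrand's postulate gives `p ≤ 2 * 442368 * (m + 1) ≤ 1769472 * m`.
  · have : p ≤ 2 ^ 21 * m := by omega
    exact_mod_cast this
  · exact Nat.floor_le (by positivity)
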